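/- Let $k,m\ge 0$ be integers, let $(\Omega,\mathcal F,\mathbb P)$ be a probability space and let $U\subset\mathbb R^m$ be a nonempty compact set. Assume the following. (A.1) $W=(W_t)_{t\in\mathbb N}$ is a sequence of i.i.d. random vectors in $\mathbb R^{k+m}$. (A.2) $G\colon\mathbb R^k\times\mathbb R^{k+m}\to\mathbb R^k$ is Borel measurable, and $x\mapsto G(x,w)$ is continuous for every $w$. (The factor process is $X_{t+1}=G(X_t,W_t)$.) (A.3) $F\colon\mathbb R^k\times U\times\mathbb R^{k+m}\to\mathbb R$ is Borel measurable, and $(x,h)\mapsto F(x,h,w)$ is continuous for every $w$. (The one-period log-return of the portfolio is $F(X_t,H_t,W_t)$.) (A.4) There are a continuous function $\omega\colon\mathbb R^k\to[0,\infty)$, Borel functions $a_1,a_2\colon\mathbb R^{k+m}\to[0,\infty)$ and constants $b_1\in(0,1)$, $b_2>0$ such that $$\omega(G(x,w))\le a_1(w)+b_1\omega(x),\qquad |F(x,h,w)|\le a_2(w)+b_2\omega(x)$$ for all $x\in\mathbb R^k$, $h\in U$, $w\in\mathbb R^{k+m}$, and such that $\mu^\gamma(a_1(W_0))$ and $\mu^\gamma(a_2(W_0))$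 are finite for all $\gamma\in\mathbb R$, where $\mu^\gamma(Z)=\frac1\gamma\ln\mathbb E[e^{\gamma Z}]$ for $\gamma\ne0$ and $\mu^0(Z)=\mathbb E[Z]$. (A.5) For every $R>0$ there are a constant $c>0$ and a probability measure $\nu$ on $\mathbb R^k$ such that $\mathbb P[G(x,W_0)\in A]\ge c\,\nu(A)$ for all Borel sets $A\subset\mathbb R^k$ and all $x$ with $\omega(x)\le R$. Let $\mathcal C_\omega(\mathbb R^k)$ be the set of continuous functions $f\colon\mathbb R^k\to\mathbb R$ with $\sup_x\frac{|f(x)|}{1+\omega(x)}<\infty$. For $\gamma<0$, a solution of the Bellman equation with parameter $\gamma$ is a pair $(u,\lambda)\in\mathcal C_\omega(\mathbb R^k)\times\mathbb R$ such that for all $x\in\mathbb R^k$ $$u(x)+\lambda\gamma=\inf_{h\in U}\ln\mathbb E\big[e^{\gamma F(x,h,W_0)+u(G(x,W_0))}\big].$$ Then there is $\gamma_0<0$ such that for every $\gamma\in(\gamma_0,0)$ there is a solution $(u_\gamma,\lambda_\gamma)$ of the Bellman equation with parameter $\gamma$, where $\lambda_\gamma$ is unique and $u_\gamma$ is unique up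 to an additive constant. Moreover, for every $\gamma_0<0$ such that the Bellman equation has a solution $(u_\gamma,\lambda_\gamma)$ for each $\gamma\in(\gamma_0,0)$, the map $\gamma\mapsto\lambda_\gamma$ is continuous on $(\gamma_0,0)$, and for all fixed $a,x\in\mathbb R^k$ the map $\gamma\mapsto\bar u_\gamma(x)=u_\gamma(x)-u_\gamma(a)$ is continuous on $(\gamma_0,0)$. -/

import Mathlib

open MeasureTheory ProbabilityTheory Set

/-- The Euclidean space of column vectors with `n` real coordinates. -/
abbrev Vec (n : ℕ) : Type := EuclideanSpace ℝ (Fin n)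

/-- The entropic utility measure `μ^γ(X)`, with values in the extended reals: it is
`(1/γ) ln E[exp (γ X)]` for `γ ≠ 0`, and `E[X]` for `γ = 0`. -/
noncomputable def entropicUtility {Ω : Type*} [MeasurableSpace Ω] (P : Measure Ω)
    (γ : ℝ) (X : Ω → ℝ) : EReal :=
  if γ = 0 then
    ((∫⁻ o, ENNReal.ofReal (X o) ∂P : ENNReal) : EReal)
      - ((∫⁻ o, ENNReal.ofReal (-X o) ∂P : ENNReal) : EReal)
  else
    ((γ⁻¹ : ℝ) : EReal) * ENNReal.log (∫⁻ o, ENNReal.ofReal (Real.exp (γ * X o)) ∂P)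

/-- The standing assumptions on the market model. The noise is `W`, the compact set of admissible
controls is `U`, the factor process follows `X (t+1) = G (X t) (W t)`, and the one-period
log-return of the portfolio under the control `h` is `F (X t) h (W t)`. -/
structure MarketAssumptions {Ω : Type*} [MeasurableSpace Ω] (P : Measure Ω) {k m : ℕ}
    (W : ℕ → Ω → Vec (k + m)) (U : Set (Vec m))
    (G : Vec k → Vec (k + m) → Vec k) (F : Vec k → U → Vec (k + m) → ℝ)
    (ω : Vec k → ℝ) (a₁ a₂ : Vec (k + m) → ℝ) (b₁ b₂ : ℝ) : Prop where
  -- the noise is a sequence of i.i.d. random vectors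
  measurable_noise : ∀ t, Measurable (W t)
  indep_noise : iIndepFun W P
  identDistrib_noise : ∀ t, IdentDistrib (W t) (W 0) P P
  -- the set of controls
  nonempty_controls : U.Nonempty
  compact_controls : IsCompact U
  -- the factor dynamics
  measurable_factor : Measurable (fun p : Vec k × Vec (k + m) => G p.1 p.2)
  continuous_factor : ∀ w, Continuous (fun x => G x w)
  -- the one-period log-returns
  measurable_return : Measurable (fun p : Vec k × U × Vec (k + m) => F p.1 p.2.1 p.2.2)
  continuous_return : ∀ w, Continuous (fun p : Vec k × U => F p.1 p.2 w)
  -- the weight function and the growth conditions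
  continuous_weight : Continuous ω
  weight_nonneg : ∀ x, 0 ≤ ω x
  measurable_a₁ : Measurable a₁
  measurable_a₂ : Measurable a₂
  a₁_nonneg : ∀ w, 0 ≤ a₁ w
  a₂_nonneg : ∀ w, 0 ≤ a₂ w
  b₁_mem : b₁ ∈ Ioo (0 : ℝ) 1
  b₂_pos : 0 < b₂
  factor_growth : ∀ x w, ω (G x w) ≤ a₁ w + b₁ * ω x
  return_growth : ∀ x h w, |F x h w| ≤ a₂ w + b₂ * ω x
  entropic_a₁ : ∀ γ : ℝ, ∃ r : ℝ, entropicUtility P γ (fun o => a₁ (W 0 o)) = (r : EReal)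
  entropic_a₂ : ∀ γ : ℝ, ∃ r : ℝ, entropicUtility P γ (fun o => a₂ (W 0 o)) = (r : EReal)
  -- the local minorization condition
  minorization : ∀ R : ℝ, 0 < R → ∃ c : ℝ, 0 < c ∧ ∃ ν : Measure (Vec k),
    IsProbabilityMeasure ν ∧ ∀ x, ω x ≤ R → ∀ A : Set (Vec k), MeasurableSet A →
      c * ν.real A ≤ P.real {o | G x (W 0 o) ∈ A}

/-- The space of continuous functions `f` with `sup_x |f x| / (1 + ω x) < ∞`. -/
def weightedSpace {k : ℕ} (ω : Vec k → ℝ) : Set (Vec k → ℝ) :=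
  {f | Continuous f ∧ BddAbove (range fun x => |f x| / (1 + ω x))}

/-- The Bellman operator `T_γ f (x) = inf_{h ∈ U} ln E[exp (γ F(x, h, W₀) + f (G(x, W₀)))]`. Under
the market assumptions, with `f` in the weighted space, the random variables are integrable and
the infimum is that of a nonempty set that is bounded below. -/
noncomputable def bellmanOperator {Ω : Type*} [MeasurableSpace Ω] (P : Measure Ω) {k m : ℕ}
    (W : ℕ → Ω → Vec (k + m)) (U : Set (Vec m))
    (G : Vec k → Vec (k + m) → Vec k) (F : Vec k → U → Vec (k + m) → ℝ)
    (γ : ℝ) (f : Vec k → ℝ) (x : Vec k) : ℝ :=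
  ⨅ h : U, Real.log (∫ o, Real.exp (γ * F x h (W 0 o) + f (G x (W 0 o))) ∂P)

/-- The pair `(u, l)` solves the Bellman equation `u(x) + l γ = T_γ u (x)`, with `u` in the weighted
space. -/
def IsBellmanSolution {Ω : Type*} [MeasurableSpace Ω] (P : Measure Ω) {k m : ℕ}
    (W : ℕ → Ω → Vec (k + m)) (U : Set (Vec m))
    (G : Vec k → Vec (k + m) → Vec k) (F : Vec k → U → Vec (k + m) → ℝ)
    (ω : Vec k → ℝ) (γ : ℝ) (u : Vec k → ℝ) (l : ℝ) : Prop :=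
  u ∈ weightedSpace ω ∧ ∀ x, u x + l * γ = bellmanOperator P W U G F γ u x

/-! The Bellman equation says that `u` is an additive eigenfunction of `bellmanOperator` with
eigenvalue `l * γ`. At `γ = 0` the zero function is one, with eigenvalue `0`, and everything else is
perturbation from a known eigenfunction.

The Gibbs variational inequality bounds the difference of the control values of `f` and `g` by the
mean of `f - g` under an exponentially tilted transition law. Finite exponential moments of `a₁`
preserve the geometric drift under tilting (`exists_drift`), and the local minorization gives an
overlap of the tilted laws on sublevel sets of `ω` (`exists_overlap`); both hold uniformly for `|γ|
≤ Γ` and `|f| ≤ M (1 + ω)`. As in the Hairer-Mattingly form of Harris's theorem, the operator then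
contracts an oscillation weighted by `1 + β ω` (`exists_contraction`).

The rate depends on `M`, so there is no global fixed point argument. But the operator is Lipschitz
in `γ` (`exists_lipschitz`), so for `γ` near `γ₀` its version normalised at `0` maps a small ball
around an eigenfunction for `γ₀` into itself and has a fixed point there
(`exists_perturbed_eigenfunction`). At `γ₀ = 0` this gives existence. At any other parameter,
together with uniqueness up to constants (`eigenfunction_unique`), it gives continuity. -/

/-- Nonnegative random variables all of whose exponential moments are finite. -/
structure FiniteExpMoments {Ω : Type*} [MeasurableSpace Ω] (P : Measure Ω) (a : Ω → ℝ) : Prop where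
  measurable : Measurable a
  nonneg : ∀ o, 0 ≤ a o
  integrable_exp : ∀ t : ℝ, Integrable (fun o => Real.exp (t * a o)) P

/-! ### Exponential moments and exponential changes of measure -/

namespace FiniteExpMoments

variable {Ω : Type*} [MeasurableSpace Ω] {P : Measure Ω} {a b : Ω → ℝ}

theorem const_mul (ha : FiniteExpMoments P a) {c : ℝ} (hc : 0 ≤ c) :
    FiniteExpMoments P (fun o => c * a o) where
  measurable := ha.measurable.const_mul c
  nonneg o := mul_nonneg hc (ha.nonneg o)
  integrable_exp t := by simpa only [mul_assoc] using ha.integrable_exp (t * c)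

theorem add (ha : FiniteExpMoments P a) (hb : FiniteExpMoments P b) :
    FiniteExpMoments P (fun o => a o + b o) where
  measurable := ha.measurable.add hb.measurable
  nonneg o := add_nonneg (ha.nonneg o) (hb.nonneg o)
  integrable_exp t := by
    refine Integrable.mono' ((ha.integrable_exp (2 * t)).add (hb.integrable_exp (2 * t)))
      (((ha.measurable.add hb.measurable).const_mul t).exp.aestronglyMeasurable)
      (Filter.Eventually.of_forall fun o => ?_)
    rw [Real.norm_eq_abs, Real.abs_exp]
    have h1 : Real.exp (t * (a o + b o)) = Real.exp (t * a o) * Real.exp (t * b o) := by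
      rw [← Real.exp_add]; ring_nf
    have h2 : Real.exp (2 * t * a o) = Real.exp (t * a o) ^ 2 := by
      rw [sq, ← Real.exp_add]; ring_nf
    have h3 : Real.exp (2 * t * b o) = Real.exp (t * b o) ^ 2 := by
      rw [sq, ← Real.exp_add]; ring_nf
    simp only [Pi.add_apply]
    rw [h1, h2, h3]
    nlinarith [sq_nonneg (Real.exp (t * a o) - Real.exp (t * b o)), Real.exp_pos (t * a o),
      Real.exp_pos (t * b o), mul_pos (Real.exp_pos (t * a o)) (Real.exp_pos (t * b o))]

theorem integrable_exp_one (ha : FiniteExpMoments P a) :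
    Integrable (fun o => Real.exp (a o)) P := by
  simpa using ha.integrable_exp 1

/-- A measurable function bounded by an affine function of `a` is integrable. -/
theorem integrable_of_abs_le [IsFiniteMeasure P] (ha : FiniteExpMoments P a) {X : Ω → ℝ}
    (hX : Measurable X) {s : ℝ} (h : ∀ o, |X o| ≤ a o + s) : Integrable X P := by
  refine Integrable.mono' (ha.integrable_exp_one.add (integrable_const s))
    hX.aestronglyMeasurable (Filter.Eventually.of_forall fun o => ?_)
  have := Real.add_one_le_exp (a o)
  simp only [Pi.add_apply, Real.norm_eq_abs]
  linarith [h o]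

theorem integrable [IsFiniteMeasure P] (ha : FiniteExpMoments P a) : Integrable a P :=
  ha.integrable_of_abs_le (s := 0) ha.measurable
    fun o => by rw [abs_of_nonneg (ha.nonneg o), add_zero]

/-- The exponential of a function bounded by an affine function of `a` is integrable. -/
theorem integrable_exp_of_abs_le (ha : FiniteExpMoments P a) {Y : Ω → ℝ}
    (hY : Measurable Y) {s : ℝ} (h : ∀ o, |Y o| ≤ a o + s) :
    Integrable (fun o => Real.exp (Y o)) P := by
  refine Integrable.mono' (ha.integrable_exp_one.const_mul (Real.exp s))
    hY.exp.aestronglyMeasurable (Filter.Eventually.of_forall fun o => ?_)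
  rw [Real.norm_eq_abs, Real.abs_exp, ← Real.exp_add]
  exact Real.exp_le_exp.2 (by linarith [le_abs_self (Y o), h o])

theorem integrable_exp_mul_of_abs_le (ha : FiniteExpMoments P a) (hb : FiniteExpMoments P b)
    {Y X : Ω → ℝ} (hY : Measurable Y) {s t : ℝ} (h : ∀ o, |Y o| ≤ a o + s)
    (hX : Measurable X) (hXb : ∀ o, |X o| ≤ b o + t) :
    Integrable (fun o => Real.exp (Y o) * X o) P := by
  refine Integrable.mono' ((ha.add hb).integrable_exp_one.const_mul (Real.exp (s + t)))
    (hY.exp.mul hX).aestronglyMeasurable (Filter.Eventually.of_forall fun o => ?_)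
  rw [Real.norm_eq_abs, abs_mul, Real.abs_exp, ← Real.exp_add]
  have h1 : Real.exp (Y o) ≤ Real.exp (a o + s) :=
    Real.exp_le_exp.2 (by linarith [le_abs_self (Y o), h o])
  have h2 : |X o| ≤ Real.exp (b o + t) := by linarith [Real.add_one_le_exp (b o + t), hXb o]
  calc Real.exp (Y o) * |X o| ≤ Real.exp (a o + s) * Real.exp (b o + t) :=
        mul_le_mul h1 h2 (abs_nonneg _) (Real.exp_pos _).le
    _ = _ := by rw [← Real.exp_add]; ring_nf

theorem integral_exp_le [IsProbabilityMeasure P] (ha : FiniteExpMoments P a) {Y : Ω → ℝ}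
    (hY : Measurable Y) {s : ℝ} (h : ∀ o, |Y o| ≤ a o + s) :
    ∫ o, Real.exp (Y o) ∂P ≤ Real.exp s * ∫ o, Real.exp (a o) ∂P := by
  rw [← integral_const_mul]
  refine integral_mono (ha.integrable_exp_of_abs_le hY h)
    (ha.integrable_exp_one.const_mul _) fun o => ?_
  simp only
  rw [← Real.exp_add]
  exact Real.exp_le_exp.2 (by linarith [le_abs_self (Y o), h o])

theorem integral_tilted_eq (P : Measure Ω) (Y X : Ω → ℝ) : ∫ o, X o ∂(P.tilted Y)
    = (∫ o, Real.exp (Y o) * X o ∂P) / ∫ o, Real.exp (Y o) ∂P := by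
  rw [integral_tilted, ← integral_div]
  congr 1; ext o; rw [smul_eq_mul]; ring

section Tilted

variable [IsProbabilityMeasure P] {p : Ω → ℝ} (hp : FiniteExpMoments P p) {Y : Ω → ℝ}
  (hY : Measurable Y) {s : ℝ} (hYp : ∀ o, |Y o| ≤ p o + s)

include hp hY hYp

omit [IsProbabilityMeasure P] in
theorem integrable_tilted (ha : FiniteExpMoments P a) {X : Ω → ℝ} (hX : Measurable X) {t : ℝ}
    (h : ∀ o, |X o| ≤ a o + t) : Integrable X (P.tilted Y) := by
  rw [integrable_tilted_iff (hp.integrable_exp_of_abs_le hY hYp)]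
  simpa only [smul_eq_mul] using hp.integrable_exp_mul_of_abs_le ha hY hYp hX h

theorem isProbabilityMeasure_tilted : IsProbabilityMeasure (P.tilted Y) :=
  MeasureTheory.isProbabilityMeasure_tilted (hp.integrable_exp_of_abs_le hY hYp)

/-- The Gibbs variational inequality for the logarithmic moment generating functional. -/
theorem log_integral_exp_sub_le {p' Y' : Ω → ℝ} (hp' : FiniteExpMoments P p')
    (hY' : Measurable Y') {s' : ℝ} (hYp' : ∀ o, |Y' o| ≤ p' o + s') :
    Real.log (∫ o, Real.exp (Y o) ∂P) - Real.log (∫ o, Real.exp (Y' o) ∂P)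
      ≤ ∫ o, (Y o - Y' o) ∂(P.tilted Y) := by
  have hI := hp.integrable_exp_of_abs_le hY hYp
  have hI' := hp'.integrable_exp_of_abs_le hY' hYp'
  have hpos := integral_exp_pos hI
  have hD : Integrable (fun o => Real.exp (Y o) * (Y o - Y' o)) P :=
    hp.integrable_exp_mul_of_abs_le (hp.add hp') hY hYp (hY.sub hY') (t := s + s') fun o => by
      have := abs_sub (Y o) (Y' o)
      linarith [hYp o, hYp' o]
  have hint : (∫ o, (Y o - Y' o) ∂(P.tilted Y)) * ∫ o, Real.exp (Y o) ∂P
      = ∫ o, Real.exp (Y o) * (Y o - Y' o) ∂P := by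
    rw [integral_tilted_eq, div_mul_cancel₀ _ hpos.ne']
  set q := ∫ o, (Y o - Y' o) ∂(P.tilted Y)
  -- Integrate the tangent inequality `1 + z ≤ exp z` at `z = Y' - Y + q`; the shift by `q` makes
  -- `z` have mean zero under the tilted measure.
  have key : Real.exp (-q) * ∫ o, Real.exp (Y o) ∂P ≤ ∫ o, Real.exp (Y' o) ∂P := by
    have h1 : ∫ o, Real.exp (-q) * (Real.exp (Y o) * (1 + q) - Real.exp (Y o) * (Y o - Y' o)) ∂P
        ≤ ∫ o, Real.exp (Y' o) ∂P := by
      refine integral_mono (((hI.mul_const _).sub hD).const_mul _) hI' fun o => ?_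
      have h2 : Real.exp (Y' o) = Real.exp (-q) * (Real.exp (Y o) * Real.exp (Y' o - Y o + q)) := by
        rw [← Real.exp_add, ← Real.exp_add]; ring_nf
      simp only
      rw [h2]
      refine mul_le_mul_of_nonneg_left ?_ (Real.exp_pos _).le
      have := mul_le_mul_of_nonneg_left (Real.add_one_le_exp (Y' o - Y o + q))
        (Real.exp_pos (Y o)).le
      linarith
    rw [integral_const_mul, integral_sub (hI.mul_const _) hD, integral_mul_const, ← hint] at h1
    convert h1 using 2
    ring
  have := Real.log_le_log (mul_pos (Real.exp_pos _) hpos) key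
  rw [Real.log_mul (Real.exp_pos _).ne' hpos.ne', Real.log_exp] at this
  linarith

omit hp hY hYp in
theorem zero (P : Measure Ω) [IsProbabilityMeasure P] : FiniteExpMoments P (fun _ => 0) where
  measurable := measurable_const
  nonneg _ := le_rfl
  integrable_exp t := by simp

/-- Jensen's inequality, read off from the Gibbs inequality with first exponent zero, whose tilted
measure is `P` itself. -/
theorem neg_le_log_integral_exp :
    -(∫ o, p o ∂P + s) ≤ Real.log (∫ o, Real.exp (Y o) ∂P) := by
  have h := (zero P).log_integral_exp_sub_le (Y := fun _ => 0) measurable_const (s := 0)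
    (by simp) hp hY hYp
  rw [show (fun _ : Ω => (0 : ℝ)) = 0 from rfl, tilted_zero] at h
  have hYi := hp.integrable_of_abs_le hY hYp
  have h2 : ∫ o, -Y o ∂P ≤ ∫ o, (p o + s) ∂P :=
    integral_mono hYi.neg (hp.integrable.add (integrable_const s)) fun o => by
      have := neg_abs_le (Y o)
      linarith [hYp o]
  rw [integral_add hp.integrable (integrable_const s)] at h2
  simp at h h2
  linarith

theorem log_integral_exp_le :
    Real.log (∫ o, Real.exp (Y o) ∂P) ≤ s + Real.log (∫ o, Real.exp (p o) ∂P) := by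
  have h := Real.log_le_log (integral_exp_pos (hp.integrable_exp_of_abs_le hY hYp))
    (hp.integral_exp_le hY hYp)
  rwa [Real.log_mul (Real.exp_pos _).ne' (integral_exp_pos hp.integrable_exp_one).ne',
    Real.log_exp] at h

/-- The mean of `a` under an exponential change of measure, by the entropy inequality. -/
theorem integral_tilted_le (ha : FiniteExpMoments P a) {δ : ℝ} (hδ : 0 < δ) :
    ∫ o, a o ∂(P.tilted Y)
      ≤ (Real.log (∫ o, Real.exp (p o + δ * a o) ∂P) + ∫ o, p o ∂P + 2 * s) / δ := by
  have hpa := hp.add (ha.const_mul hδ.le)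
  have hYa : Measurable fun o => Y o + δ * a o := hY.add (ha.measurable.const_mul δ)
  have hb : ∀ o, |Y o + δ * a o| ≤ p o + δ * a o + s := fun o => by
    have h1 := abs_add_le (Y o) (δ * a o)
    have h2 := abs_of_nonneg (mul_nonneg hδ.le (ha.nonneg o))
    linarith [hYp o]
  -- Comparing `Y` with `Y + δ a` turns the mean of `a` into a difference of logarithmic moments.
  -- The size `s` of the exponent enters only through `2 s / δ`, hence weakly when `δ` is large.
  have h1 := hp.log_integral_exp_sub_le hY hYp hpa hYa hb
  have h2 := hpa.log_integral_exp_le hYa hb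
  have h3 := hp.neg_le_log_integral_exp hY hYp
  have h4 : ∫ o, (Y o - (Y o + δ * a o)) ∂(P.tilted Y) = -(δ * ∫ o, a o ∂(P.tilted Y)) := by
    rw [← integral_const_mul, ← integral_neg]
    congr 1; ext o; ring
  rw [le_div_iff₀ hδ]
  rw [h4] at h1
  linarith

/-- Exponential changes of measure cannot make events of positive probability negligible. -/
theorem sq_integral_le_integral_tilted {ψ : Ω → ℝ} (hψ : Measurable ψ) (h0 : ∀ o, 0 ≤ ψ o)
    (h1 : ∀ o, ψ o ≤ 1) :
    Real.exp (-(2 * s)) * (∫ o, ψ o ∂P) ^ 2 / (∫ o, Real.exp (p o) ∂P) ^ 2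
      ≤ ∫ o, ψ o ∂(P.tilted Y) := by
  have hI := hp.integrable_exp_of_abs_le hY hYp
  have hpos := integral_exp_pos hI
  have hppos := integral_exp_pos hp.integrable_exp_one
  have hψ' : ∀ o, |ψ o| ≤ (fun _ : Ω => (0 : ℝ)) o + 1 := fun o => by
    rw [abs_of_nonneg (h0 o)]; simpa using h1 o
  have hψi : Integrable ψ P := (zero P).integrable_of_abs_le hψ hψ'
  have hYψ := hp.integrable_exp_mul_of_abs_le (zero P) hY hYp hψ hψ'
  rw [integral_tilted_eq]
  set B := ∫ o, Real.exp (p o) ∂P with hB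
  set e := ∫ o, ψ o ∂P with he
  -- Cauchy-Schwarz in the form `e² ≤ B E[exp (-p) ψ]`, obtained by integrating a pointwise square
  -- with the optimal multiplier `e / B`.
  have hnum : Real.exp (-s) * (e ^ 2 / B) ≤ ∫ o, Real.exp (Y o) * ψ o ∂P := by
    have h2 : ∫ o, Real.exp (-s) * (2 * (e / B) * ψ o - (e / B) ^ 2 * Real.exp (p o)) ∂P
        ≤ ∫ o, Real.exp (Y o) * ψ o ∂P := by
      refine integral_mono (((hψi.const_mul _).sub
        (hp.integrable_exp_one.const_mul _)).const_mul _) hYψ fun o => ?_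
      have h3 : Real.exp (-s) * Real.exp (-p o) ≤ Real.exp (Y o) := by
        rw [← Real.exp_add]
        exact Real.exp_le_exp.2 (by linarith [neg_abs_le (Y o), hYp o])
      have h4 : Real.exp (-p o) * Real.exp (p o) = 1 := by rw [← Real.exp_add]; simp
      have h5 : 2 * (e / B) * ψ o - (e / B) ^ 2 * Real.exp (p o) ≤ Real.exp (-p o) * ψ o := by
        have h6 : 0 ≤ ψ o * (Real.exp (-p o) * (1 - (e / B) * Real.exp (p o)) ^ 2) :=
          mul_nonneg (h0 o) (mul_nonneg (Real.exp_pos _).le (sq_nonneg _))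
        have h7 : ψ o * (Real.exp (-p o) * (1 - (e / B) * Real.exp (p o)) ^ 2)
            = Real.exp (-p o) * ψ o - 2 * (e / B) * ψ o * (Real.exp (-p o) * Real.exp (p o))
              + ψ o * ((e / B) ^ 2 * (Real.exp (-p o) * Real.exp (p o)) * Real.exp (p o)) := by
          ring
        have h8 : ψ o * ((e / B) ^ 2 * Real.exp (p o)) ≤ 1 * ((e / B) ^ 2 * Real.exp (p o)) :=
          mul_le_mul_of_nonneg_right (h1 o) (by positivity)
        rw [h7, h4] at h6
        linarith
      calc Real.exp (-s) * (2 * (e / B) * ψ o - (e / B) ^ 2 * Real.exp (p o))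
          ≤ Real.exp (-s) * (Real.exp (-p o) * ψ o) :=
            mul_le_mul_of_nonneg_left h5 (Real.exp_pos _).le
        _ = Real.exp (-s) * Real.exp (-p o) * ψ o := by ring
        _ ≤ _ := mul_le_mul_of_nonneg_right h3 (h0 o)
    rw [integral_const_mul, integral_sub (hψi.const_mul _) (hp.integrable_exp_one.const_mul _),
      integral_const_mul, integral_const_mul, ← hB, ← he] at h2
    convert h2 using 2
    field_simp
    ring
  have hden := hp.integral_exp_le hY hYp
  rw [← hB] at hden
  rw [le_div_iff₀ hpos]
  refine le_trans ?_ hnum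
  calc Real.exp (-(2 * s)) * e ^ 2 / B ^ 2 * ∫ o, Real.exp (Y o) ∂P
      ≤ Real.exp (-(2 * s)) * e ^ 2 / B ^ 2 * (Real.exp s * B) :=
        mul_le_mul_of_nonneg_left hden (by positivity)
    _ = (Real.exp (-(2 * s)) * Real.exp s) * (e ^ 2 / B) := by field_simp
    _ = _ := by rw [← Real.exp_add]; ring_nf

end Tilted

end FiniteExpMoments

/-! ### The weighted oscillation -/

/-- The oscillation of `φ` relative to the weight `1 + β ω` is at most `D`. -/
def WeightedSpanLE {X : Type*} (ω : X → ℝ) (β D : ℝ) (φ : X → ℝ) : Prop :=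
  ∀ x y, φ x - φ y ≤ D * (2 + β * ω x + β * ω y)

namespace WeightedSpanLE

variable {X : Type*} {ω φ ψ : X → ℝ} {β D E : ℝ}

theorem add (h : WeightedSpanLE ω β D φ) (h' : WeightedSpanLE ω β E ψ) :
    WeightedSpanLE ω β (D + E) (fun x => φ x + ψ x) := fun x y => by
  have h1 := h x y
  have h2 := h' x y
  simp only
  linarith

theorem of_abs_le (h : ∀ x, |φ x| ≤ D * (1 + β * ω x)) : WeightedSpanLE ω β D φ := fun x y => by
  have h1 := h x
  have h2 := h y
  have h3 := le_abs_self (φ x)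
  have h4 := neg_abs_le (φ y)
  linarith

theorem abs_sub_le (h : WeightedSpanLE ω β D φ) (x y : X) :
    |φ x - φ y| ≤ D * (2 + β * ω x + β * ω y) := by
  have h1 := h x y
  have h2 := h y x
  exact abs_le.2 ⟨by linarith, h1⟩

/-- Every `φ x - D (1 + β ω x)` lies below every `φ y + D (1 + β ω y)`, and any number separating
the two families serves as `c`. Thus the oscillation is a weighted sup norm modulo constants. -/
theorem exists_abs_sub_const_le [Nonempty X] (h : WeightedSpanLE ω β D φ) :
    ∃ c, ∀ x, |φ x - c| ≤ D * (1 + β * ω x) := by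
  have hb : ∀ x, BddBelow (range fun y => φ y + D * (1 + β * ω y)) := fun x =>
    ⟨φ x - D * (1 + β * ω x), by
      rintro _ ⟨y, rfl⟩
      have := h x y
      simp only
      linarith⟩
  refine ⟨⨅ y, (φ y + D * (1 + β * ω y)), fun x => abs_le.2 ⟨?_, ?_⟩⟩
  · have := ciInf_le (hb x) x
    linarith
  · have : φ x - D * (1 + β * ω x) ≤ ⨅ y, (φ y + D * (1 + β * ω y)) := le_ciInf fun y => by
      have := h x y
      linarith
    linarith

/-- The overlap of two laws bounds the difference of the means of `φ`. -/
theorem integral_sub_integral_le [Nonempty X] [MeasurableSpace X] {μ₁ μ₂ : Measure X}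
    [IsProbabilityMeasure μ₁] [IsProbabilityMeasure μ₂] (h : WeightedSpanLE ω β D φ)
    (hβ : 0 ≤ β) (hD : 0 < D) (hω : ∀ x, 0 ≤ ω x) (hωm : Measurable ω) (hφ : Measurable φ)
    (hω₁ : Integrable ω μ₁) (hω₂ : Integrable ω μ₂) {η : ℝ}
    (hη : ∀ χ : X → ℝ, Measurable χ → (∀ x, 0 ≤ χ x) → (∀ x, χ x ≤ 1) →
      η ≤ ∫ x, χ x ∂μ₁ + ∫ x, (1 - χ x) ∂μ₂) :
    ∫ x, φ x ∂μ₁ - ∫ x, φ x ∂μ₂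
      ≤ D * (2 - 2 * η + β * (∫ x, ω x ∂μ₁ + ∫ x, ω x ∂μ₂)) := by
  obtain ⟨c, hc⟩ := h.exists_abs_sub_const_le
  have hw : ∀ x, 0 < D * (1 + β * ω x) := fun x =>
    mul_pos hD (by nlinarith [mul_nonneg hβ (hω x)])
  have hwm : Measurable fun x => D * (1 + β * ω x) := ((hωm.const_mul β).const_add 1).const_mul D
  set r : X → ℝ := fun x => (φ x - c) / (D * (1 + β * ω x)) with hr
  have hrm : Measurable r := (hφ.sub_const c).div hwm
  have hr1 : ∀ x, |r x| ≤ 1 := fun x => by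
    rw [hr, abs_div, abs_of_pos (hw x)]
    exact (div_le_one (hw x)).2 (hc x)
  have hri : ∀ (μ : Measure X) [IsProbabilityMeasure μ], Integrable r μ := fun μ _ =>
    Integrable.mono' (integrable_const (1 : ℝ)) hrm.aestronglyMeasurable
      (Filter.Eventually.of_forall hr1)
  have hwi : ∀ (μ : Measure X) [IsProbabilityMeasure μ], Integrable ω μ →
      Integrable (fun x => D * (1 + β * ω x)) μ := fun μ _ hμ =>
    ((integrable_const (1 : ℝ)).add (hμ.const_mul β)).const_mul D
  have hφi : ∀ (μ : Measure X) [IsProbabilityMeasure μ], Integrable ω μ → Integrable φ μ := by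
    intro μ _ hμ
    have h1 : Integrable (fun x => φ x - c) μ :=
      Integrable.mono' (hwi μ hμ) (hφ.sub_const c).aestronglyMeasurable
        (Filter.Eventually.of_forall hc)
    exact (h1.add (integrable_const c)).congr
      (Filter.Eventually.of_forall fun x => sub_add_cancel (φ x) c)
  have hφr : ∀ x, φ x = r x * (D * (1 + β * ω x)) + c := fun x => by
    rw [hr]
    simp only
    rw [div_mul_cancel₀ _ (hw x).ne', sub_add_cancel]
  have hli : ∀ (μ : Measure X) [IsProbabilityMeasure μ], Integrable ω μ → ∀ t : ℝ,
      Integrable (fun x => D * r x + t * ω x) μ := fun μ _ hμ t =>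
    ((hri μ).const_mul D).add (hμ.const_mul t)
  have hl : ∀ (μ : Measure X) [IsProbabilityMeasure μ], Integrable ω μ → ∀ t : ℝ,
      ∫ x, (D * r x + t * ω x + c) ∂μ = D * ∫ x, r x ∂μ + t * ∫ x, ω x ∂μ + c := by
    intro μ _ hμ t
    rw [integral_add (hli μ hμ t) (integrable_const c),
      integral_add ((hri μ).const_mul D) (hμ.const_mul t), integral_const_mul, integral_const_mul]
    simp
  have h1 : ∫ x, φ x ∂μ₁ ≤ D * ∫ x, r x ∂μ₁ + D * β * ∫ x, ω x ∂μ₁ + c := by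
    rw [← hl μ₁ hω₁]
    refine integral_mono (hφi μ₁ hω₁) ((hli μ₁ hω₁ _).add (integrable_const c)) fun x => ?_
    have h2 := mul_le_mul_of_nonneg_right (le_of_abs_le (hr1 x))
      (mul_nonneg hD.le (mul_nonneg hβ (hω x)))
    rw [hφr x]
    linarith
  have h2 : D * ∫ x, r x ∂μ₂ + -(D * β) * ∫ x, ω x ∂μ₂ + c ≤ ∫ x, φ x ∂μ₂ := by
    rw [← hl μ₂ hω₂]
    refine integral_mono ((hli μ₂ hω₂ _).add (integrable_const c)) (hφi μ₂ hω₂) fun x => ?_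
    have h2 := mul_le_mul_of_nonneg_right (neg_le_of_abs_le (hr1 x))
      (mul_nonneg hD.le (mul_nonneg hβ (hω x)))
    rw [hφr x]
    linarith
  -- This test function turns the overlap hypothesis into `∫ r ∂μ₁ - ∫ r ∂μ₂ ≤ 2 - 2 η`.
  have h3 := hη (fun x => (1 - r x) / 2) ((hrm.const_sub 1).div_const 2)
    (fun x => by have := le_of_abs_le (hr1 x); linarith)
    (fun x => by have := neg_le_of_abs_le (hr1 x); linarith)
  have h4 : ∫ x, (1 - r x) / 2 ∂μ₁ = (1 - ∫ x, r x ∂μ₁) / 2 := by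
    rw [integral_div, integral_sub (integrable_const _) (hri μ₁)]; simp
  have h5 : ∫ x, (1 - (1 - r x) / 2) ∂μ₂ = (1 + ∫ x, r x ∂μ₂) / 2 := by
    rw [show (fun x => 1 - (1 - r x) / 2) = fun x => (1 + r x) / 2 by ext x; ring, integral_div,
      integral_add (integrable_const _) (hri μ₂)]
    simp
  rw [h4, h5] at h3
  have h6 := mul_le_mul_of_nonneg_left h3 hD.le
  linarith

end WeightedSpanLE

/-! ### Tilted transition laws: drift and overlap -/

/-- Measurable functions with `|f| ≤ M (1 + ω)`. -/
structure GrowthBound {X : Type*} [MeasurableSpace X] (ω : X → ℝ) (M : ℝ) (f : X → ℝ) : Prop where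
  measurable : Measurable f
  abs_le : ∀ x, |f x| ≤ M * (1 + ω x)

/-- The law of `G(x, W₀)` under the probability measure with density proportional to
`exp (γ F(x, h, W₀) + f (G(x, W₀)))`. -/
noncomputable def tiltedLaw {Ω : Type*} [MeasurableSpace Ω] (P : Measure Ω) {k m : ℕ}
    (W : ℕ → Ω → Vec (k + m)) {U : Set (Vec m)}
    (G : Vec k → Vec (k + m) → Vec k) (F : Vec k → U → Vec (k + m) → ℝ)
    (γ : ℝ) (f : Vec k → ℝ) (x : Vec k) (h : U) : Measure (Vec k) :=
  (P.tilted fun o => γ * F x h (W 0 o) + f (G x (W 0 o))).map fun o => G x (W 0 o)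

/-- An infinite moment of order `t` would make the utility `⊤` or `⊥`, according to the sign of `t`.
-/
theorem finiteExpMoments_of_entropicUtility {Ω : Type*} [MeasurableSpace Ω] {P : Measure Ω}
    [IsProbabilityMeasure P] {a : Ω → ℝ} (hm : Measurable a) (h0 : ∀ o, 0 ≤ a o)
    (h : ∀ γ : ℝ, ∃ r : ℝ, entropicUtility P γ a = (r : EReal)) : FiniteExpMoments P a where
  measurable := hm
  nonneg := h0
  integrable_exp t := by
    rcases eq_or_ne t 0 with rfl | ht
    · simp
    obtain ⟨r, hr⟩ := h t
    rw [entropicUtility, if_neg ht] at hr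
    refine ⟨(hm.const_mul t).exp.aestronglyMeasurable, ?_⟩
    rw [hasFiniteIntegral_iff_ofReal (Filter.Eventually.of_forall fun o => (Real.exp_pos _).le)]
    refine lt_top_iff_ne_top.2 fun htop => ?_
    rw [htop, ENNReal.log_top] at hr
    rcases lt_or_gt_of_ne (inv_ne_zero ht) with h' | h'
    · rw [EReal.coe_mul_top_of_neg h'] at hr
      exact absurd hr (EReal.bot_ne_coe r)
    · rw [EReal.coe_mul_top_of_pos h'] at hr
      exact absurd hr (EReal.top_ne_coe r)

namespace MarketAssumptions

variable {Ω : Type*} [MeasurableSpace Ω] {P : Measure Ω} [IsProbabilityMeasure P] {k m : ℕ}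
  {W : ℕ → Ω → Vec (k + m)} {U : Set (Vec m)} {G : Vec k → Vec (k + m) → Vec k}
  {F : Vec k → U → Vec (k + m) → ℝ} {ω : Vec k → ℝ} {a₁ a₂ : Vec (k + m) → ℝ} {b₁ b₂ : ℝ}
  (hA : MarketAssumptions P W U G F ω a₁ a₂ b₁ b₂)

include hA

theorem finiteExpMoments_a₁ : FiniteExpMoments P fun o => a₁ (W 0 o) :=
  finiteExpMoments_of_entropicUtility (hA.measurable_a₁.comp (hA.measurable_noise 0))
    (fun _ => hA.a₁_nonneg _) hA.entropic_a₁

theorem finiteExpMoments_a₂ : FiniteExpMoments P fun o => a₂ (W 0 o) :=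
  finiteExpMoments_of_entropicUtility (hA.measurable_a₂.comp (hA.measurable_noise 0))
    (fun _ => hA.a₂_nonneg _) hA.entropic_a₂

theorem finiteExpMoments_bound {Γ M : ℝ} (hΓ : 0 ≤ Γ) (hM : 0 ≤ M) :
    FiniteExpMoments P fun o => Γ * a₂ (W 0 o) + M * a₁ (W 0 o) :=
  (hA.finiteExpMoments_a₂.const_mul hΓ).add (hA.finiteExpMoments_a₁.const_mul hM)

omit [IsProbabilityMeasure P] in
theorem measurable_next (x : Vec k) : Measurable fun o => G x (W 0 o) :=
  hA.measurable_factor.comp (measurable_const.prodMk (hA.measurable_noise 0))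

omit [IsProbabilityMeasure P] in
theorem measurable_gain (x : Vec k) (h : U) : Measurable fun o => F x h (W 0 o) :=
  hA.measurable_return.comp
    (measurable_const.prodMk (measurable_const.prodMk (hA.measurable_noise 0)))

omit [IsProbabilityMeasure P] in
theorem measurable_exponent {γ : ℝ} {f : Vec k → ℝ} (hf : Measurable f) (x : Vec k) (h : U) :
    Measurable fun o => γ * F x h (W 0 o) + f (G x (W 0 o)) :=
  ((hA.measurable_gain x h).const_mul γ).add (hf.comp (hA.measurable_next x))

omit [IsProbabilityMeasure P] in
-- The noise and the state separate: the random envelope depends only on `Γ` and `M`, and `x` enters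
-- through a deterministic shift linear in `ω x`. This is the source of all uniformity below.
theorem abs_exponent_le {Γ M γ : ℝ} (hγ : |γ| ≤ Γ) (hM : 0 ≤ M) {f : Vec k → ℝ}
    (hf : ∀ x, |f x| ≤ M * (1 + ω x)) (x : Vec k) (h : U) (o : Ω) :
    |γ * F x h (W 0 o) + f (G x (W 0 o))|
      ≤ Γ * a₂ (W 0 o) + M * a₁ (W 0 o) + ((Γ * b₂ + M * b₁) * ω x + M) := by
  have h1 := abs_add_le (γ * F x h (W 0 o)) (f (G x (W 0 o)))
  have h2 : |γ * F x h (W 0 o)| ≤ Γ * (a₂ (W 0 o) + b₂ * ω x) := by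
    rw [abs_mul]
    exact mul_le_mul hγ (hA.return_growth x h _) (abs_nonneg _) ((abs_nonneg γ).trans hγ)
  have h3 := mul_le_mul_of_nonneg_left (hA.factor_growth x (W 0 o)) hM
  have h4 := hf (G x (W 0 o))
  linarith

section Tilted

variable {Γ M : ℝ} (hM : 0 ≤ M)

include hM

/-- Under the tilted measures a function with exponential moments has a mean of small linear growth
in the weight. -/
theorem exists_integral_tilted_le (hΓ : 0 ≤ Γ) {a : Ω → ℝ} (ha : FiniteExpMoments P a) {η : ℝ}
    (hη : 0 < η) :
    ∃ K, 0 ≤ K ∧ ∀ γ : ℝ, |γ| ≤ Γ → ∀ f, GrowthBound ω M f → ∀ (x : Vec k) (h : U),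
      ∫ o, a o ∂(P.tilted fun o => γ * F x h (W 0 o) + f (G x (W 0 o))) ≤ K + η * ω x := by
  have hp := hA.finiteExpMoments_bound hΓ hM
  set C := Γ * b₂ + M * b₁ with hC
  have hC0 : 0 ≤ C := add_nonneg (mul_nonneg hΓ hA.b₂_pos.le) (mul_nonneg hM hA.b₁_mem.1.le)
  -- Large enough that the slope `2 C / δ` is at most `η`.
  set δ := 2 * C / η + 1 with hδ
  have hδ0 : 0 < δ := by positivity
  refine ⟨|(Real.log (∫ o, Real.exp (Γ * a₂ (W 0 o) + M * a₁ (W 0 o) + δ * a o) ∂P)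
    + ∫ o, (Γ * a₂ (W 0 o) + M * a₁ (W 0 o)) ∂P + 2 * M) / δ|, abs_nonneg _,
    fun γ hγ f hf x h => ?_⟩
  have h1 := hp.integral_tilted_le (hA.measurable_exponent hf.measurable x h)
    (hA.abs_exponent_le hγ hM hf.abs_le x h) ha hδ0
  refine h1.trans ?_
  rw [show ∀ A B : ℝ, (A + B + 2 * (C * ω x + M)) / δ
    = (A + B + 2 * M) / δ + 2 * C / δ * ω x by intros; ring]
  refine add_le_add (le_abs_self _) (mul_le_mul_of_nonneg_right ?_ (hA.weight_nonneg x))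
  rw [div_le_iff₀ hδ0, show η * δ = 2 * C + η by rw [hδ]; field_simp]
  linarith

variable {γ : ℝ} (hγ : |γ| ≤ Γ) {f : Vec k → ℝ} (hf : GrowthBound ω M f) (x : Vec k) (h : U)

include hγ hf

theorem isProbabilityMeasure_tilted :
    IsProbabilityMeasure (P.tilted fun o => γ * F x h (W 0 o) + f (G x (W 0 o))) :=
  (hA.finiteExpMoments_bound ((abs_nonneg γ).trans hγ) hM).isProbabilityMeasure_tilted
    (hA.measurable_exponent hf.measurable x h) (hA.abs_exponent_le hγ hM hf.abs_le x h)

theorem isProbabilityMeasure_tiltedLaw : IsProbabilityMeasure (tiltedLaw P W G F γ f x h) :=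
  have := hA.isProbabilityMeasure_tilted hM hγ hf x h
  Measure.isProbabilityMeasure_map (hA.measurable_next x).aemeasurable

omit [IsProbabilityMeasure P] hM hγ hf in
theorem integral_tiltedLaw {φ : Vec k → ℝ} (hφ : Measurable φ) :
    ∫ z, φ z ∂(tiltedLaw P W G F γ f x h)
      = ∫ o, φ (G x (W 0 o)) ∂(P.tilted fun o => γ * F x h (W 0 o) + f (G x (W 0 o))) :=
  integral_map (hA.measurable_next x).aemeasurable hφ.aestronglyMeasurable

theorem integrable_tilted_of_abs_le {a : Ω → ℝ} (ha : FiniteExpMoments P a) {X : Ω → ℝ}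
    (hX : Measurable X) {t : ℝ} (hXa : ∀ o, |X o| ≤ a o + t) :
    Integrable X (P.tilted fun o => γ * F x h (W 0 o) + f (G x (W 0 o))) :=
  (hA.finiteExpMoments_bound ((abs_nonneg γ).trans hγ) hM).integrable_tilted
    (hA.measurable_exponent hf.measurable x h) (hA.abs_exponent_le hγ hM hf.abs_le x h) ha hX hXa

theorem integrable_weight_next :
    Integrable (fun o => ω (G x (W 0 o)))
      (P.tilted fun o => γ * F x h (W 0 o) + f (G x (W 0 o))) :=
  hA.integrable_tilted_of_abs_le hM hγ hf x h hA.finiteExpMoments_a₁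
    (hA.continuous_weight.measurable.comp (hA.measurable_next x)) (t := b₁ * ω x) fun o => by
      simpa only [Function.comp, abs_of_nonneg (hA.weight_nonneg _)]
        using hA.factor_growth x (W 0 o)

theorem integrable_weight_tiltedLaw : Integrable ω (tiltedLaw P W G F γ f x h) :=
  (integrable_map_measure hA.continuous_weight.measurable.aestronglyMeasurable
    (hA.measurable_next x).aemeasurable).2 (hA.integrable_weight_next hM hγ hf x h)

theorem integral_weight_next_le :
    ∫ o, ω (G x (W 0 o)) ∂(P.tilted fun o => γ * F x h (W 0 o) + f (G x (W 0 o)))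
      ≤ ∫ o, a₁ (W 0 o) ∂(P.tilted fun o => γ * F x h (W 0 o) + f (G x (W 0 o))) + b₁ * ω x := by
  have := hA.isProbabilityMeasure_tilted hM hγ hf x h
  have hi := hA.integrable_tilted_of_abs_le hM hγ hf x h hA.finiteExpMoments_a₁
    hA.finiteExpMoments_a₁.measurable (t := 0) fun o => by
      rw [abs_of_nonneg (hA.a₁_nonneg _), add_zero]
  have h1 := integral_mono (hA.integrable_weight_next hM hγ hf x h)
    (hi.add (integrable_const (b₁ * ω x))) fun o => hA.factor_growth x (W 0 o)
  rw [show (((fun o => a₁ (W 0 o)) + fun _ => b₁ * ω x) : Ω → ℝ)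
    = fun o => a₁ (W 0 o) + b₁ * ω x from rfl, integral_add hi (integrable_const _)] at h1
  simpa using h1

omit hγ hf x h in
/-- The geometric drift condition, uniformly over the tilted transition laws. -/
theorem exists_drift (hΓ : 0 ≤ Γ) :
    ∃ b K, 0 < b ∧ b < 1 ∧ 0 ≤ K ∧ ∀ γ : ℝ, |γ| ≤ Γ → ∀ f, GrowthBound ω M f →
      ∀ (x : Vec k) (h : U), ∫ z, ω z ∂(tiltedLaw P W G F γ f x h) ≤ b * ω x + K := by
  have hb0 := hA.b₁_mem.1
  have hb1 := hA.b₁_mem.2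
  -- Half of the gap `1 - b₁` is spent on the tilt, leaving the rate `(1 + b₁) / 2 < 1`.
  obtain ⟨K, hK, h1⟩ := hA.exists_integral_tilted_le hM hΓ hA.finiteExpMoments_a₁
    (η := (1 - b₁) / 2) (by linarith)
  refine ⟨(1 + b₁) / 2, K, by linarith, by linarith, hK, fun γ hγ f hf x h => ?_⟩
  rw [hA.integral_tiltedLaw x h hA.continuous_weight.measurable]
  have h2 := hA.integral_weight_next_le hM hγ hf x h
  have h3 := h1 γ hγ f hf x h
  linarith

omit hM hγ hf x h in
theorem const_mul_integral_le {R c : ℝ} (hc : 0 < c) {ν : Measure (Vec k)}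
    [IsProbabilityMeasure ν]
    (hν : ∀ x, ω x ≤ R → ∀ A : Set (Vec k), MeasurableSet A →
      c * ν.real A ≤ P.real {o | G x (W 0 o) ∈ A})
    {x : Vec k} (hx : ω x ≤ R) {χ : Vec k → ℝ} (hχ : Measurable χ) (h0 : ∀ x, 0 ≤ χ x)
    (h1 : ∀ x, χ x ≤ 1) :
    c * ∫ z, χ z ∂ν ≤ ∫ o, χ (G x (W 0 o)) ∂P := by
  have : IsProbabilityMeasure (P.map fun o => G x (W 0 o)) :=
    Measure.isProbabilityMeasure_map (hA.measurable_next x).aemeasurable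
  have hle : ENNReal.ofReal c • ν ≤ P.map fun o => G x (W 0 o) := by
    refine Measure.le_iff.2 fun A hAm => ?_
    rw [Measure.map_apply (hA.measurable_next x) hAm, Measure.smul_apply, smul_eq_mul,
      ← ofReal_measureReal (μ := ν), ← ENNReal.ofReal_mul hc.le, ← ofReal_measureReal (μ := P)]
    exact ENNReal.ofReal_le_ofReal (hν x hx A hAm)
  have hi : Integrable χ (P.map fun o => G x (W 0 o)) :=
    Integrable.mono' (integrable_const (1 : ℝ)) hχ.aestronglyMeasurable
      (Filter.Eventually.of_forall fun z => by rw [Real.norm_of_nonneg (h0 z)]; exact h1 z)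
  have h2 := integral_mono_measure hle (Filter.Eventually.of_forall h0) hi
  rwa [integral_smul_measure, ENNReal.toReal_ofReal hc.le, smul_eq_mul,
    integral_map (hA.measurable_next x).aemeasurable hχ.aestronglyMeasurable] at h2

omit hγ hf x h in
/-- The tilted transition laws from two points of small weight overlap. -/
theorem exists_overlap (hΓ : 0 ≤ Γ) {R : ℝ} (hR : 0 < R) :
    ∃ η, 0 < η ∧ ∀ γ : ℝ, |γ| ≤ Γ → ∀ f, GrowthBound ω M f → ∀ g, GrowthBound ω M g →
      ∀ (x y : Vec k) (h h' : U), ω x ≤ R → ω y ≤ R → ∀ χ : Vec k → ℝ, Measurable χ →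
      (∀ x, 0 ≤ χ x) → (∀ x, χ x ≤ 1) →
      η ≤ ∫ z, χ z ∂(tiltedLaw P W G F γ f x h)
        + ∫ z, (1 - χ z) ∂(tiltedLaw P W G F γ g y h') := by
  obtain ⟨c, hc, ν, hν, hmin⟩ := hA.minorization R hR
  have hp := hA.finiteExpMoments_bound hΓ hM
  set C := Γ * b₂ + M * b₁ with hC
  have hC0 : 0 ≤ C := add_nonneg (mul_nonneg hΓ hA.b₂_pos.le) (mul_nonneg hM hA.b₁_mem.1.le)
  set B := ∫ o, Real.exp (Γ * a₂ (W 0 o) + M * a₁ (W 0 o)) ∂P with hB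
  have hB0 : 0 < B := integral_exp_pos hp.integrable_exp_one
  set q := Real.exp (-(2 * (C * R + M))) * c ^ 2 / B ^ 2 with hq
  have hq0 : 0 < q := by positivity
  have key : ∀ γ : ℝ, |γ| ≤ Γ → ∀ f, GrowthBound ω M f → ∀ (x : Vec k) (h : U), ω x ≤ R →
      ∀ χ : Vec k → ℝ, Measurable χ → (∀ x, 0 ≤ χ x) → (∀ x, χ x ≤ 1) →
      q * (∫ z, χ z ∂ν) ^ 2 ≤ ∫ z, χ z ∂(tiltedLaw P W G F γ f x h) := by
    intro γ hγ f hf x h hx χ hχ h0 h1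
    rw [hA.integral_tiltedLaw x h hχ]
    have h2 := hp.sq_integral_le_integral_tilted (hA.measurable_exponent hf.measurable x h)
      (hA.abs_exponent_le hγ hM hf.abs_le x h) (hχ.comp (hA.measurable_next x))
      (fun o => h0 _) (fun o => h1 _)
    refine le_trans ?_ h2
    have h3 := hA.const_mul_integral_le hc hmin hx hχ h0 h1
    have h4 : 0 ≤ ∫ z, χ z ∂ν := integral_nonneg h0
    have h5 : (c * ∫ z, χ z ∂ν) ^ 2 ≤ (∫ o, χ (G x (W 0 o)) ∂P) ^ 2 :=
      pow_le_pow_left₀ (mul_nonneg hc.le h4) h3 2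
    have h6 : Real.exp (-(2 * (C * R + M))) ≤ Real.exp (-(2 * (C * ω x + M))) :=
      Real.exp_le_exp.2 (by linarith [mul_le_mul_of_nonneg_left hx hC0])
    calc q * (∫ z, χ z ∂ν) ^ 2
        = Real.exp (-(2 * (C * R + M))) * (c * ∫ z, χ z ∂ν) ^ 2 / B ^ 2 := by rw [hq]; ring
      _ ≤ _ := by
        rw [Function.comp_def, ← hB]
        exact div_le_div_of_nonneg_right (mul_le_mul h6 h5 (sq_nonneg _) (Real.exp_pos _).le)
          (sq_nonneg _)
  -- For `t = ∫ χ ∂ν`, the two bounds add up to `q (t² + (1 - t)²) ≥ q / 2`.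
  refine ⟨q / 2, by positivity, fun γ hγ f hf g hg x y h h' hx hy χ hχ h0 h1 => ?_⟩
  have h2 := key γ hγ f hf x h hx χ hχ h0 h1
  have h3 := key γ hγ g hg y h' hy (fun z => 1 - χ z) (hχ.const_sub 1)
    (fun z => sub_nonneg.2 (h1 z)) (fun z => by linarith [h0 z])
  have hi : Integrable χ ν := Integrable.mono' (integrable_const (1 : ℝ)) hχ.aestronglyMeasurable
      (Filter.Eventually.of_forall fun z => by rw [Real.norm_of_nonneg (h0 z)]; exact h1 z)
  have h4 : ∫ z, (1 - χ z) ∂ν = 1 - ∫ z, χ z ∂ν := by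
    rw [integral_sub (integrable_const _) hi]; simp
  rw [h4] at h3
  nlinarith [mul_nonneg hq0.le (sq_nonneg (2 * ∫ z, χ z ∂ν - 1))]

end Tilted

end MarketAssumptions

/-! ### The Bellman operator: contraction, Lipschitz dependence, continuity -/

theorem iInf_le_iInf_add {ι : Type*} [Nonempty ι] {p q : ι → ℝ} (hp : BddBelow (range p)) {C : ℝ}
    (h : ∀ i, p i ≤ q i + C) : ⨅ i, p i ≤ (⨅ i, q i) + C := by
  have : (⨅ i, p i) - C ≤ ⨅ i, q i := le_ciInf fun i => by
    have := ciInf_le hp i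
    linarith [h i]
  linarith

/-- The indices decouple, so the infima can be treated one after the other and no minimisers are
needed. -/
theorem iInf_sub_iInf_add_le {ι : Type*} [Nonempty ι] {p q p' q' : ι → ℝ}
    (hp : BddBelow (range p)) (hq : BddBelow (range q')) {B : ℝ}
    (h : ∀ i j, p i - q i + (q' j - p' j) ≤ B) :
    ((⨅ i, p i) - ⨅ i, q i) - ((⨅ i, p' i) - ⨅ i, q' i) ≤ B := by
  have h1 : ∀ j, ⨅ i, p i ≤ (⨅ i, q i) + (B - (q' j - p' j)) := fun j =>
    iInf_le_iInf_add hp fun i => by linarith [h i j]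
  have h2 : ⨅ i, q' i ≤ (⨅ i, p' i) + (B - ((⨅ i, p i) - ⨅ i, q i)) :=
    iInf_le_iInf_add hq fun j => by linarith [h1 j]
  linarith

namespace GrowthBound

variable {X : Type*} [MeasurableSpace X] {ω : X → ℝ} {M M' : ℝ} {f g : X → ℝ}

theorem mono (hf : GrowthBound ω M f) (hω : ∀ x, 0 ≤ ω x) (h : M ≤ M') : GrowthBound ω M' f where
  measurable := hf.measurable
  abs_le x := (hf.abs_le x).trans (mul_le_mul_of_nonneg_right h (by linarith [hω x]))

end GrowthBound

theorem mem_weightedSpace_of_abs_le {k : ℕ} {ω : Vec k → ℝ} (hω : ∀ x, 0 ≤ ω x) {f : Vec k → ℝ}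
    (hf : Continuous f) {M : ℝ} (h : ∀ x, |f x| ≤ M * (1 + ω x)) : f ∈ weightedSpace ω :=
  ⟨hf, M, by
    rintro _ ⟨x, rfl⟩
    exact (div_le_iff₀ (by linarith [hω x])).2 (h x)⟩

theorem exists_growthBound {k : ℕ} {ω : Vec k → ℝ} (hω : ∀ x, 0 ≤ ω x) {f : Vec k → ℝ}
    (hf : f ∈ weightedSpace ω) : ∃ M, 0 ≤ M ∧ GrowthBound ω M f := by
  obtain ⟨hc, M, hM⟩ := hf
  have h : ∀ x, |f x| ≤ M * (1 + ω x) := fun x =>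
    (div_le_iff₀ (by linarith [hω x])).1 (hM ⟨x, rfl⟩)
  have hM0 : 0 ≤ M := (div_nonneg (abs_nonneg (f 0)) (by linarith [hω 0])).trans (hM ⟨0, rfl⟩)
  exact ⟨M, hM0, hc.measurable, h⟩

/-- The value `ln E[exp (γ F(x, h, W₀) + f (G(x, W₀)))]` of the control `h`. -/
noncomputable def controlValue {Ω : Type*} [MeasurableSpace Ω] (P : Measure Ω) {k m : ℕ}
    (W : ℕ → Ω → Vec (k + m)) {U : Set (Vec m)}
    (G : Vec k → Vec (k + m) → Vec k) (F : Vec k → U → Vec (k + m) → ℝ)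
    (γ : ℝ) (f : Vec k → ℝ) (x : Vec k) (h : U) : ℝ :=
  Real.log (∫ o, Real.exp (γ * F x h (W 0 o) + f (G x (W 0 o))) ∂P)

theorem bellmanOperator_eq_iInf {Ω : Type*} [MeasurableSpace Ω] (P : Measure Ω) {k m : ℕ}
    (W : ℕ → Ω → Vec (k + m)) (U : Set (Vec m))
    (G : Vec k → Vec (k + m) → Vec k) (F : Vec k → U → Vec (k + m) → ℝ)
    (γ : ℝ) (f : Vec k → ℝ) (x : Vec k) :
    bellmanOperator P W U G F γ f x = ⨅ h : U, controlValue P W G F γ f x h :=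
  rfl

namespace MarketAssumptions

variable {Ω : Type*} [MeasurableSpace Ω] {P : Measure Ω} [IsProbabilityMeasure P] {k m : ℕ}
  {W : ℕ → Ω → Vec (k + m)} {U : Set (Vec m)} {G : Vec k → Vec (k + m) → Vec k}
  {F : Vec k → U → Vec (k + m) → ℝ} {ω : Vec k → ℝ} {a₁ a₂ : Vec (k + m) → ℝ} {b₁ b₂ : ℝ}
  (hA : MarketAssumptions P W U G F ω a₁ a₂ b₁ b₂) {Γ M : ℝ} (hM : 0 ≤ M)

include hA hM

theorem bddBelow_controlValue {γ : ℝ} {f : Vec k → ℝ} (hf : GrowthBound ω M f) (x : Vec k) :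
    BddBelow (range (controlValue P W G F γ f x)) :=
  ⟨_, by
    rintro _ ⟨h, rfl⟩
    exact (hA.finiteExpMoments_bound (abs_nonneg γ) hM).neg_le_log_integral_exp
      (hA.measurable_exponent hf.measurable x h) (hA.abs_exponent_le le_rfl hM hf.abs_le x h)⟩

/-- The difference of two control values is at most a mean under the first tilted measure. -/
theorem controlValue_sub_le {γ γ' : ℝ} {f g : Vec k → ℝ} (hf : GrowthBound ω M f)
    (hg : GrowthBound ω M g) (x : Vec k) (h : U) :
    controlValue P W G F γ f x h - controlValue P W G F γ' g x h
      ≤ ∫ o, ((γ * F x h (W 0 o) + f (G x (W 0 o))) - (γ' * F x h (W 0 o) + g (G x (W 0 o))))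
        ∂(P.tilted fun o => γ * F x h (W 0 o) + f (G x (W 0 o))) :=
  (hA.finiteExpMoments_bound (abs_nonneg γ) hM).log_integral_exp_sub_le
    (hA.measurable_exponent hf.measurable x h) (hA.abs_exponent_le le_rfl hM hf.abs_le x h)
    (hA.finiteExpMoments_bound (abs_nonneg γ') hM)
    (hA.measurable_exponent hg.measurable x h) (hA.abs_exponent_le le_rfl hM hg.abs_le x h)

/-- With equal parameters the return terms cancel, leaving a function of the next state alone. -/
theorem controlValue_sub_le_integral_tiltedLaw {γ : ℝ} {f g : Vec k → ℝ}
    (hf : GrowthBound ω M f) (hg : GrowthBound ω M g) (x : Vec k) (h : U) :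
    controlValue P W G F γ f x h - controlValue P W G F γ g x h
      ≤ ∫ z, (f z - g z) ∂(tiltedLaw P W G F γ f x h) := by
  rw [hA.integral_tiltedLaw (φ := fun z => f z - g z) x h (hf.measurable.sub hg.measurable)]
  simpa only [add_sub_add_left_eq_sub] using hA.controlValue_sub_le hM (γ := γ) (γ' := γ) hf hg x h

omit [IsProbabilityMeasure P] hM in
theorem nonempty_control : Nonempty U := hA.nonempty_controls.to_subtype

/-- The Bellman operator contracts the weighted oscillation, uniformly on functions of the same
growth. -/
theorem exists_contraction (hΓ : 0 ≤ Γ) :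
    ∃ β α, 0 < β ∧ β ≤ 1 ∧ 0 < α ∧ α < 1 ∧ ∀ γ : ℝ, |γ| ≤ Γ → ∀ f, GrowthBound ω M f →
      ∀ g, GrowthBound ω M g → ∀ D, 0 < D → WeightedSpanLE ω β D (fun x => f x - g x) →
      WeightedSpanLE ω β (α * D)
        (fun x => bellmanOperator P W U G F γ f x - bellmanOperator P W U G F γ g x) := by
  have := hA.nonempty_control
  obtain ⟨b, K, hb0, hb1, hK, hdrift⟩ := hA.exists_drift hM hΓ
  -- Beyond total weight `R` the additive drift constants `2 K` are absorbed by half of the gap `1 -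
  -- b`.
  set R := 4 * K / (1 - b) + 1 with hR
  have hb1' : 0 < 1 - b := by linarith
  have hR0 : 0 < R := by positivity
  have hRK : 2 * K ≤ (1 - b) / 2 * R := by
    have : (1 - b) / 2 * R = 2 * K + (1 - b) / 2 := by rw [hR]; field_simp; ring
    linarith
  obtain ⟨η, hη, hover⟩ := hA.exists_overlap hM hΓ hR0
  -- Small enough that the drift constants cost at most `η`, half of the gain `2 η` from the
  -- overlap.
  set β := min 1 (η / (2 * K + 1)) with hβ
  have hβ0 : 0 < β := by positivity
  have hβ1 : β ≤ 1 := min_le_left _ _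
  have hβK : β * (2 * K) ≤ η := by
    have h1 : β * (2 * K + 1) ≤ η := (le_div_iff₀ (by positivity)).1 (min_le_right _ _)
    linarith
  -- The ratio `(2 + β (1 + b) / 2 * S) / (2 + β S)` decreases in `S`; this is its value at `S = R`.
  set α₁ := (2 + β * ((1 + b) / 2) * R) / (2 + β * R) with hα₁
  have hβR : 0 < β * R := mul_pos hβ0 hR0
  have hα₁1 : α₁ < 1 := (div_lt_one (by positivity)).2 (by nlinarith)
  refine ⟨β, max (max (1 - η / 2) b) α₁, hβ0, hβ1,
    hb0.trans_le ((le_max_right _ _).trans (le_max_left _ _)),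
    max_lt (max_lt (by linarith) hb1) hα₁1, fun γ hγ f hf g hg D hD hspan x y => ?_⟩
  set α := max (max (1 - η / 2) b) α₁ with hα
  simp only [bellmanOperator_eq_iInf]
  refine iInf_sub_iInf_add_le (hA.bddBelow_controlValue hM hf x)
    (hA.bddBelow_controlValue hM hg y) fun h h' => ?_
  have h1 := hA.controlValue_sub_le_integral_tiltedLaw hM (γ := γ) hf hg x h
  have h2 := hA.controlValue_sub_le_integral_tiltedLaw hM (γ := γ) hg hf y h'
  have h3 : ∫ z, (g z - f z) ∂(tiltedLaw P W G F γ g y h')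
      = -∫ z, (f z - g z) ∂(tiltedLaw P W G F γ g y h') := by
    rw [← integral_neg]; congr 1; ext z; ring
  have hx := hdrift γ hγ f hf x h
  have hy := hdrift γ hγ g hg y h'
  have := hA.isProbabilityMeasure_tiltedLaw hM hγ hf x h
  have := hA.isProbabilityMeasure_tiltedLaw hM hγ hg y h'
  have hmain := fun ζ hζ => hspan.integral_sub_integral_le (η := ζ) hβ0.le hD hA.weight_nonneg
    hA.continuous_weight.measurable (hf.measurable.sub hg.measurable)
    (hA.integrable_weight_tiltedLaw hM hγ hf x h)
    (hA.integrable_weight_tiltedLaw hM hγ hg y h') hζ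
  have hωx := hA.weight_nonneg x
  have hωy := hA.weight_nonneg y
  set S := ω x + ω y with hS
  have hS0 : 0 ≤ S := add_nonneg hωx hωy
  have hsum : β * (∫ z, ω z ∂(tiltedLaw P W G F γ f x h) + ∫ z, ω z ∂(tiltedLaw P W G F γ g y h'))
      ≤ β * (b * S + 2 * K) := mul_le_mul_of_nonneg_left (by linarith) hβ0.le
  have hβS : 0 ≤ β * S := mul_nonneg hβ0.le hS0
  suffices hfin : ∃ ζ, (∀ χ : Vec k → ℝ, Measurable χ → (∀ x, 0 ≤ χ x) → (∀ x, χ x ≤ 1) →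
      ζ ≤ ∫ z, χ z ∂(tiltedLaw P W G F γ f x h)
        + ∫ z, (1 - χ z) ∂(tiltedLaw P W G F γ g y h')) ∧
      2 - 2 * ζ + β * (b * S + 2 * K) ≤ α * (2 + β * S) by
    obtain ⟨ζ, hζ, hle⟩ := hfin
    have h4 := hmain ζ hζ
    have h5 := mul_le_mul_of_nonneg_left ((add_le_add_right hsum (2 - 2 * ζ)).trans hle) hD.le
    rw [h3] at h2
    calc _ ≤ _ := by linarith
      _ ≤ D * (α * (2 + β * S)) := h5
      _ = _ := by rw [hS]; ring
  -- For large total weight the drift alone contracts, with trivial overlap `0`. Otherwise both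
  -- weights are below `R` and the overlap `η` applies.
  rcases le_or_gt R S with hRS | hRS
  · refine ⟨0, fun χ _ h0 h1 => add_nonneg (integral_nonneg h0)
      (integral_nonneg fun z => sub_nonneg.2 (h1 z)), ?_⟩
    have h6 : 2 + β * ((1 + b) / 2) * S ≤ α₁ * (2 + β * S) := by
      rw [hα₁, div_mul_eq_mul_div, le_div_iff₀ (by positivity)]
      have : 0 ≤ β * (1 - b) * (S - R) :=
        mul_nonneg (mul_nonneg hβ0.le hb1'.le) (sub_nonneg.2 hRS)
      nlinarith
    have h7 : α₁ * (2 + β * S) ≤ α * (2 + β * S) :=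
      mul_le_mul_of_nonneg_right (le_max_right _ _) (by linarith)
    have h8 : 2 * K ≤ (1 - b) / 2 * S :=
      hRK.trans (mul_le_mul_of_nonneg_left hRS (by linarith))
    have h9 := mul_le_mul_of_nonneg_left h8 hβ0.le
    linarith
  · refine ⟨η, hover γ hγ f hf g hg x y h h' (by linarith) (by linarith), ?_⟩
    have h6 : 1 - η / 2 ≤ α := (le_max_left _ _).trans (le_max_left _ _)
    have h7 : b * (β * S) ≤ α * (β * S) :=
      mul_le_mul_of_nonneg_right ((le_max_right _ _).trans (le_max_left _ _)) hβS
    linarith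

/-- The Bellman operator is Lipschitz in the parameter and in the function, locally uniformly. -/
theorem exists_lipschitz (hΓ : 0 ≤ Γ) :
    ∃ K, 0 < K ∧ ∀ γ : ℝ, |γ| ≤ Γ → ∀ γ' : ℝ, |γ'| ≤ Γ → ∀ f, GrowthBound ω M f →
      ∀ g, GrowthBound ω M g → ∀ e, 0 ≤ e → (∀ x, |f x - g x| ≤ e * (1 + ω x)) →
      ∀ x, |bellmanOperator P W U G F γ f x - bellmanOperator P W U G F γ' g x|
        ≤ K * (|γ - γ'| + e) * (1 + ω x) := by
  have := hA.nonempty_control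
  obtain ⟨b, K, hb0, hb1, hK, hdrift⟩ := hA.exists_drift hM hΓ
  obtain ⟨K₂, hK₂, ha₂⟩ := hA.exists_integral_tilted_le hM hΓ hA.finiteExpMoments_a₂ zero_lt_one
  have hb₂ := hA.b₂_pos
  have key : ∀ γ : ℝ, |γ| ≤ Γ → ∀ γ' : ℝ, |γ'| ≤ Γ → ∀ f, GrowthBound ω M f →
      ∀ g, GrowthBound ω M g → ∀ e, 0 ≤ e → (∀ x, |f x - g x| ≤ e * (1 + ω x)) →
      ∀ x, bellmanOperator P W U G F γ f x ≤ bellmanOperator P W U G F γ' g x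
        + (K₂ + b₂ + K + 2) * (|γ - γ'| + e) * (1 + ω x) := by
    intro γ hγ γ' hγ' f hf g hg e he hfg x
    rw [bellmanOperator_eq_iInf, bellmanOperator_eq_iInf]
    refine iInf_le_iInf_add (hA.bddBelow_controlValue hM hf x) fun h => ?_
    have h1 := hA.controlValue_sub_le hM (γ := γ) (γ' := γ') hf hg x h
    have := hA.isProbabilityMeasure_tilted hM hγ hf x h
    have hai := hA.integrable_tilted_of_abs_le hM hγ hf x h hA.finiteExpMoments_a₂
      hA.finiteExpMoments_a₂.measurable (t := 0) fun o => by
        rw [abs_of_nonneg (hA.a₂_nonneg _), add_zero]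
    have hwi := hA.integrable_weight_next hM hγ hf x h
    have h2 := ha₂ γ hγ f hf x h
    have h3 := hdrift γ hγ f hf x h
    rw [hA.integral_tiltedLaw x h hA.continuous_weight.measurable] at h3
    set Q := P.tilted fun o => γ * F x h (W 0 o) + f (G x (W 0 o))
    set d := |γ - γ'|
    have hd : 0 ≤ d := abs_nonneg _
    have hi1 : Integrable (fun o => d * (a₂ (W 0 o) + b₂ * ω x)) Q :=
      (hai.add (integrable_const _)).const_mul d
    have hi2 : Integrable (fun o => e * (1 + ω (G x (W 0 o)))) Q :=
      ((integrable_const _).add hwi).const_mul e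
    have hpt : ∀ o, ‖(γ * F x h (W 0 o) + f (G x (W 0 o)))
        - (γ' * F x h (W 0 o) + g (G x (W 0 o)))‖
        ≤ d * (a₂ (W 0 o) + b₂ * ω x) + e * (1 + ω (G x (W 0 o))) := fun o => by
      rw [Real.norm_eq_abs, show (γ * F x h (W 0 o) + f (G x (W 0 o)))
        - (γ' * F x h (W 0 o) + g (G x (W 0 o))) = (γ - γ') * F x h (W 0 o)
          + (f (G x (W 0 o)) - g (G x (W 0 o))) by ring]
      refine (abs_add_le _ _).trans (add_le_add ?_ (hfg _))
      rw [abs_mul]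
      exact mul_le_mul_of_nonneg_left (hA.return_growth x h _) hd
    have h4 := (le_abs_self _).trans (norm_integral_le_of_norm_le (hi1.add hi2)
      (Filter.Eventually.of_forall hpt))
    have h5 : ∫ o, ((fun o => d * (a₂ (W 0 o) + b₂ * ω x))
        + fun o => e * (1 + ω (G x (W 0 o)))) o ∂Q
        = d * (∫ o, a₂ (W 0 o) ∂Q + b₂ * ω x) + e * (1 + ∫ o, ω (G x (W 0 o)) ∂Q) := by
      rw [integral_add' hi1 hi2, integral_const_mul, integral_const_mul,
        integral_add hai (integrable_const _), integral_add (integrable_const _) hwi]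
      simp
    rw [h5] at h4
    have hω := hA.weight_nonneg x
    have h6 : d * (∫ o, a₂ (W 0 o) ∂Q + b₂ * ω x) ≤ d * ((K₂ + b₂ + K + 2) * (1 + ω x)) := by
      refine mul_le_mul_of_nonneg_left ?_ hd
      nlinarith [mul_nonneg hK hω, mul_nonneg hK₂ hω]
    have h7 : e * (1 + ∫ o, ω (G x (W 0 o)) ∂Q) ≤ e * ((K₂ + b₂ + K + 2) * (1 + ω x)) := by
      refine mul_le_mul_of_nonneg_left ?_ he
      nlinarith [mul_nonneg hK hω, mul_nonneg hK₂ hω, mul_nonneg hb₂.le hω,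
        mul_le_mul_of_nonneg_right hb1.le hω]
    linarith
  refine ⟨K₂ + b₂ + K + 2, by positivity, fun γ hγ γ' hγ' f hf g hg e he hfg x => ?_⟩
  have h1 := key γ hγ γ' hγ' f hf g hg e he hfg x
  have h2 := key γ' hγ' γ hγ g hg f hf e he (fun x => by rw [abs_sub_comm]; exact hfg x) x
  rw [abs_sub_comm γ' γ] at h2
  exact abs_le.2 ⟨by linarith, by linarith⟩

/-- The Bellman operator preserves continuity. -/
theorem continuous_bellmanOperator {γ : ℝ} {f : Vec k → ℝ} (hf : GrowthBound ω M f)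
    (hfc : Continuous f) : Continuous (bellmanOperator P W U G F γ f) := by
  have hp := hA.finiteExpMoments_bound (abs_nonneg γ) hM
  have : CompactSpace U := isCompact_iff_compactSpace.1 hA.compact_controls
  set C := |γ| * b₂ + M * b₁ with hC
  have hC0 : 0 ≤ C :=
    add_nonneg (mul_nonneg (abs_nonneg γ) hA.b₂_pos.le) (mul_nonneg hM hA.b₁_mem.1.le)
  have hI : Continuous fun q : Vec k × U =>
      ∫ o, Real.exp (γ * F q.1 q.2 (W 0 o) + f (G q.1 (W 0 o))) ∂P := by
    refine continuous_iff_continuousAt.2 fun q₀ => ?_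
    refine continuousAt_of_dominated (bound := fun o =>
      Real.exp (C * (ω q₀.1 + 1) + M) * Real.exp (|γ| * a₂ (W 0 o) + M * a₁ (W 0 o))) ?_ ?_ ?_ ?_
    · exact Filter.Eventually.of_forall fun q =>
        (hA.measurable_exponent hf.measurable q.1 q.2).exp.aestronglyMeasurable
    -- The dominating function only has to work near `q₀`, where `ω` exceeds its value by less than
    -- `1`.
    · have hev : ∀ᶠ q : Vec k × U in nhds q₀, ω q.1 < ω q₀.1 + 1 :=
        (hA.continuous_weight.comp continuous_fst).continuousAt.eventually_lt continuousAt_const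
          (by simp)
      filter_upwards [hev] with q hq
      refine Filter.Eventually.of_forall fun o => ?_
      rw [Real.norm_eq_abs, Real.abs_exp, ← Real.exp_add]
      refine Real.exp_le_exp.2 ?_
      have h1 := hA.abs_exponent_le le_rfl hM hf.abs_le (γ := γ) q.1 q.2 o
      have h2 := mul_le_mul_of_nonneg_left hq.le hC0
      have h3 := le_abs_self (γ * F q.1 q.2 (W 0 o) + f (G q.1 (W 0 o)))
      linarith
    · exact hp.integrable_exp_one.const_mul _
    · exact Filter.Eventually.of_forall fun o => (Real.continuous_exp.comp
        (((hA.continuous_return (W 0 o)).const_mul γ).add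
          (hfc.comp ((hA.continuous_factor (W 0 o)).comp continuous_fst)))).continuousAt
  have hV : Continuous fun q : Vec k × U => controlValue P W G F γ f q.1 q.2 :=
    hI.log fun q => (integral_exp_pos (hp.integrable_exp_of_abs_le
      (hA.measurable_exponent hf.measurable q.1 q.2)
      (hA.abs_exponent_le le_rfl hM hf.abs_le q.1 q.2))).ne'
  have := isCompact_univ.continuous_sInf (f := fun x h => controlValue P W G F γ f x h)
    (K := (univ : Set U)) hV
  simp only [image_univ] at this
  exact this

theorem bellmanOperator_add_const {γ : ℝ} {f : Vec k → ℝ} (hf : GrowthBound ω M f) (c : ℝ)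
    (x : Vec k) :
    bellmanOperator P W U G F γ (fun z => f z + c) x = bellmanOperator P W U G F γ f x + c := by
  have := hA.nonempty_control
  have hp := hA.finiteExpMoments_bound (abs_nonneg γ) hM
  have h1 : ∀ h, controlValue P W G F γ (fun z => f z + c) x h
      = controlValue P W G F γ f x h + c := fun h => by
    have hpos := integral_exp_pos (hp.integrable_exp_of_abs_le
      (hA.measurable_exponent hf.measurable x h) (hA.abs_exponent_le le_rfl hM hf.abs_le x h))
    unfold controlValue
    simp only [← add_assoc]
    simp_rw [Real.exp_add _ c]
    rw [integral_mul_const, Real.log_mul hpos.ne' (Real.exp_pos c).ne', Real.log_exp]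
  have hb := hA.bddBelow_controlValue hM (γ := γ) hf x
  rw [bellmanOperator_eq_iInf, bellmanOperator_eq_iInf, iInf_congr h1]
  exact (ciInf_add hb c).symm

end MarketAssumptions

/-! ### Geometric convergence in the weighted oscillation -/

namespace WeightedSpanLE

variable {X : Type*} {ω φ : X → ℝ} {β D α : ℝ}

theorem eq_of_forall_pow (hα0 : 0 ≤ α) (hα1 : α < 1)
    (h : ∀ n : ℕ, WeightedSpanLE ω β (α ^ n * D) φ) (x y : X) : φ x = φ y := by
  have hlim : ∀ C : ℝ, Filter.Tendsto (fun n : ℕ => α ^ n * D * C) Filter.atTop (nhds 0) :=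
    fun C => by
      simpa using ((tendsto_pow_atTop_nhds_zero_of_lt_one hα0 hα1).mul_const D).mul_const C
  have h1 : ∀ x y, φ x - φ y ≤ 0 := fun x y =>
    ge_of_tendsto' (hlim (2 + β * ω x + β * ω y)) fun n => h n x y
  linarith [h1 x y, h1 y x]

/-- A sequence of continuous functions with a common value at `a` converges if its increments have
geometrically decreasing weighted oscillation. -/
theorem exists_limit [TopologicalSpace X] (hω : Continuous ω) (hβ : 0 ≤ β)
    (hD : 0 ≤ D) (hα0 : 0 ≤ α) (hα1 : α < 1) {a : X} {p : ℝ} {u : ℕ → X → ℝ}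
    (hu : ∀ n, Continuous (u n)) (hua : ∀ n, u n a = p)
    (h : ∀ n, WeightedSpanLE ω β (α ^ n * D) (fun x => u (n + 1) x - u n x)) :
    ∃ v, Continuous v ∧ v a = p ∧
      ∀ n, WeightedSpanLE ω β (α ^ n * (D / (1 - α))) (fun x => v x - u n x) := by
  have hα : 0 < 1 - α := by linarith
  have hdist : ∀ x y n, dist (u n x - u n y) (u (n + 1) x - u (n + 1) y)
      ≤ D * (2 + β * ω x + β * ω y) * α ^ n := fun x y n => by
    have h1 := (h n).abs_sub_le x y
    rw [Real.dist_eq, abs_sub_comm, show u (n + 1) x - u (n + 1) y - (u n x - u n y)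
      = u (n + 1) x - u n x - (u (n + 1) y - u n y) by ring]
    exact h1.trans_eq (by ring)
  have hlim : ∀ x, ∃ l, Filter.Tendsto (fun n => u n x - u n a) Filter.atTop (nhds l) := fun x =>
    cauchySeq_tendsto_of_complete (cauchySeq_of_le_geometric α _ hα1 (hdist x a))
  choose l hl using hlim
  have hla : l a = 0 := tendsto_nhds_unique (hl a) (by simp)
  have hspan : ∀ n, WeightedSpanLE ω β (α ^ n * (D / (1 - α))) (fun x => l x + p - u n x) := by
    intro n x y
    have h1 : Filter.Tendsto (fun n => u n x - u n y) Filter.atTop (nhds (l x - l y)) := by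
      simpa using (hl x).sub (hl y)
    have h2 := dist_le_of_le_geometric_of_tendsto α _ hα1 (hdist x y) h1 n
    rw [Real.dist_eq, abs_sub_comm] at h2
    have h3 := (le_abs_self _).trans h2
    calc _ = l x - l y - (u n x - u n y) := by ring
      _ ≤ _ := h3
      _ = _ := by ring
  refine ⟨fun x => l x + p, ?_, by simp [hla], hspan⟩
  -- Oscillation bounds become pointwise bounds because all values at `a` agree, and these are
  -- uniform where `ω` is bounded.
  have hloc : TendstoLocallyUniformly u (fun x => l x + p) Filter.atTop := by
    rw [Metric.tendstoLocallyUniformly_iff]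
    intro ε hε x
    refine ⟨{y | ω y < ω x + 1}, (isOpen_lt hω continuous_const).mem_nhds (by simp), ?_⟩
    set C := D / (1 - α) * (2 + β * (ω x + 1) + β * ω a) with hC
    have h1 : Filter.Tendsto (fun n : ℕ => α ^ n * C) Filter.atTop (nhds 0) := by
      simpa using (tendsto_pow_atTop_nhds_zero_of_lt_one hα0 hα1).mul_const C
    filter_upwards [h1.eventually_lt_const hε] with n hn y hy
    refine lt_of_le_of_lt ?_ hn
    have h2 := (hspan n).abs_sub_le y a
    simp only [hla, hua n, zero_add, sub_self, sub_zero] at h2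
    rw [Real.dist_eq]
    refine h2.trans ?_
    rw [hC, ← mul_assoc]
    refine mul_le_mul_of_nonneg_left ?_ (by positivity)
    have := mul_le_mul_of_nonneg_left (show ω y < ω x + 1 from hy).le hβ
    linarith
  exact hloc.continuous (Filter.Frequently.of_forall hu)

end WeightedSpanLE

/-! ### Eigenfunctions: uniqueness and perturbation -/

namespace MarketAssumptions

variable {Ω : Type*} [MeasurableSpace Ω] {P : Measure Ω} [IsProbabilityMeasure P] {k m : ℕ}
  {W : ℕ → Ω → Vec (k + m)} {U : Set (Vec m)} {G : Vec k → Vec (k + m) → Vec k}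
  {F : Vec k → U → Vec (k + m) → ℝ} {ω : Vec k → ℝ} {a₁ a₂ : Vec (k + m) → ℝ} {b₁ b₂ : ℝ}
  (hA : MarketAssumptions P W U G F ω a₁ a₂ b₁ b₂)

include hA

/-- Additive eigenfunctions of the Bellman operator are unique up to a constant. -/
theorem eigenfunction_unique {γ κ κ' : ℝ} {u u' : Vec k → ℝ} (hu : u ∈ weightedSpace ω)
    (hu' : u' ∈ weightedSpace ω) (h : ∀ x, bellmanOperator P W U G F γ u x = u x + κ)
    (h' : ∀ x, bellmanOperator P W U G F γ u' x = u' x + κ') :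
    κ' = κ ∧ ∃ c : ℝ, ∀ x, u' x = u x + c := by
  have hω := hA.weight_nonneg
  obtain ⟨M₁, hM₁, hg₁⟩ := exists_growthBound hω hu
  obtain ⟨M₂, hM₂, hg₂⟩ := exists_growthBound hω hu'
  have hM : 0 ≤ M₁ + M₂ := add_nonneg hM₁ hM₂
  have hg : GrowthBound ω (M₁ + M₂) u := hg₁.mono hω (by linarith)
  have hg' : GrowthBound ω (M₁ + M₂) u' := hg₂.mono hω (by linarith)
  obtain ⟨β, α, hβ0, hβ1, hα0, hα1, hcon⟩ := hA.exists_contraction hM (abs_nonneg γ)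
  -- Dividing by `β` passes from the weight `1 + ω` to `1 + β ω`; the `1` keeps `D` positive.
  set D := (M₁ + M₂) / β + 1 with hD
  have hD0 : 0 < D := by positivity
  have hspan : ∀ n : ℕ, WeightedSpanLE ω β (α ^ n * D) (fun x => u' x - u x) := by
    intro n
    induction n with
    | zero =>
      refine WeightedSpanLE.of_abs_le fun x => ?_
      have h1 := abs_sub (u' x) (u x)
      have h2 : (M₁ + M₂) * (1 + ω x) ≤ D * (1 + β * ω x) := by
        have h3 : D * β = M₁ + M₂ + β := by rw [hD]; field_simp
        have h4 : M₁ + M₂ ≤ D := by nlinarith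
        nlinarith [hω x, mul_nonneg hβ0.le (hω x)]
      rw [pow_zero, one_mul]
      linarith [hg₁.abs_le x, hg₂.abs_le x]
    | succ n ih =>
      -- The operator changes `u' - u` only by a constant, invisible to the oscillation, so the
      -- contraction can be iterated.
      have h1 := hcon γ le_rfl u' hg' u hg _ (by positivity) ih
      intro x y
      have h2 := h1 x y
      simp only [h, h'] at h2
      rw [pow_succ']
      linarith
  have hconst := WeightedSpanLE.eq_of_forall_pow hα0.le hα1 hspan
  have hc : ∀ x, u' x = u x + (u' 0 - u 0) := fun x => by linarith [hconst x 0]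
  refine ⟨?_, _, hc⟩
  have h1 := hA.bellmanOperator_add_const hM (γ := γ) hg (u' 0 - u 0) 0
  rw [← show u' = fun z => u z + (u' 0 - u 0) from funext hc, h, h'] at h1
  linarith

/-- Additive eigenfunctions of the Bellman operator persist, with small change, under small changes
of the parameter. -/
theorem exists_perturbed_eigenfunction {γ₀ κ₀ : ℝ} {u₀ : Vec k → ℝ} (hu₀ : u₀ ∈ weightedSpace ω)
    (h₀ : ∀ x, bellmanOperator P W U G F γ₀ u₀ x = u₀ x + κ₀) {ε : ℝ} (hε : 0 < ε) :
    ∃ δ, 0 < δ ∧ ∀ γ : ℝ, |γ - γ₀| < δ → ∃ (v : Vec k → ℝ) (κ : ℝ), v ∈ weightedSpace ω ∧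
      (∀ x, bellmanOperator P W U G F γ v x = v x + κ) ∧
      (∀ x, |v x - u₀ x| ≤ ε * (1 + ω x)) ∧ |κ - κ₀| ≤ ε := by
  have hω := hA.weight_nonneg
  have hω0 := hω 0
  obtain ⟨M₀, hM₀, hg₀⟩ := exists_growthBound hω hu₀
  -- The growth class leaves unit room around `u₀`, and the contraction constants are fixed before
  -- the radius is chosen.
  have hM : 0 ≤ M₀ + 1 := by linarith
  have hΓ : 0 ≤ |γ₀| + 1 := by positivity
  have hg₀' : GrowthBound ω (M₀ + 1) u₀ := hg₀.mono hω (by linarith)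
  obtain ⟨β, α, hβ0, hβ1, hα0, hα1, hcon⟩ := hA.exists_contraction hM hΓ
  obtain ⟨K, hK, hlip⟩ := hA.exists_lipschitz hM hΓ
  have hα : 0 < 1 - α := by linarith
  -- `ε₁` controls the eigenvalue through the Lipschitz bound at `0`, and `ρ` is the radius for
  -- which functions agreeing with `u₀` at `0` stay `ε₂`-close to it.
  set ε₁ := ε / (2 * K * (1 + ω 0)) with hε₁
  have hε₁0 : 0 < ε₁ := by positivity
  set ε₂ := min (min 1 ε) ε₁ with hε₂
  have hε₂0 : 0 < ε₂ := by positivity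
  set ρ := ε₂ / (2 + ω 0) with hρ
  have hρ0 : 0 < ρ := by positivity
  refine ⟨min (min 1 ε₁) (β * (1 - α) * ρ / K), by positivity, fun γ hγδ => ?_⟩
  have hd1 : |γ - γ₀| ≤ 1 := hγδ.le.trans ((min_le_left _ _).trans (min_le_left _ _))
  have hd2 : |γ - γ₀| ≤ ε₁ := hγδ.le.trans ((min_le_left _ _).trans (min_le_right _ _))
  have hd3 : K * |γ - γ₀| ≤ β * (1 - α) * ρ := by
    have := (le_div_iff₀ hK).1 (hγδ.le.trans (min_le_right _ _))
    linarith
  have hγ : |γ| ≤ |γ₀| + 1 := by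
    have := abs_add_le (γ - γ₀) γ₀
    rw [sub_add_cancel] at this
    linarith
  have hγ₀ : |γ₀| ≤ |γ₀| + 1 := by linarith
  have hball : ∀ f : Vec k → ℝ, f 0 = u₀ 0 → WeightedSpanLE ω β ρ (fun x => f x - u₀ x) →
      ∀ x, |f x - u₀ x| ≤ ε₂ * (1 + ω x) := by
    intro f hf0 hf x
    have h1 := hf.abs_sub_le x 0
    simp only [hf0, sub_self, sub_zero] at h1
    have h2 : ρ * (2 + ω 0) = ε₂ := by rw [hρ]; field_simp
    rw [← h2, mul_assoc]
    refine h1.trans (mul_le_mul_of_nonneg_left ?_ hρ0.le)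
    nlinarith [mul_le_mul_of_nonneg_right hβ1 (hω x), mul_le_mul_of_nonneg_right hβ1 hω0,
      mul_nonneg hω0 (hω x), hω x]
  have hballM : ∀ f : Vec k → ℝ, Continuous f → f 0 = u₀ 0 →
      WeightedSpanLE ω β ρ (fun x => f x - u₀ x) → GrowthBound ω (M₀ + 1) f := by
    refine fun f hfc hf0 hf => ⟨hfc.measurable, fun x => ?_⟩
    have h1 := hball f hf0 hf x
    have h2 : ε₂ * (1 + ω x) ≤ 1 * (1 + ω x) :=
      mul_le_mul_of_nonneg_right ((min_le_left _ _).trans (min_le_left _ _)) (by linarith [hω x])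
    have h3 := abs_add_le (f x - u₀ x) (u₀ x)
    rw [sub_add_cancel] at h3
    linarith [hg₀.abs_le x]
  -- The operator at `γ` displaces `u₀` by at most `(1 - α) ρ`; since it shrinks the radius `ρ` to
  -- `α ρ`, the ball is preserved.
  have hstep : WeightedSpanLE ω β ((1 - α) * ρ)
      (fun x => bellmanOperator P W U G F γ u₀ x - bellmanOperator P W U G F γ₀ u₀ x) := by
    refine WeightedSpanLE.of_abs_le fun x => ?_
    have h1 := hlip γ hγ γ₀ hγ₀ u₀ hg₀' u₀ hg₀' 0 le_rfl (by simp) x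
    have h2 : K * (|γ - γ₀| + 0) * (1 + ω x) ≤ β * (1 - α) * ρ * (1 + ω x) :=
      mul_le_mul_of_nonneg_right (by linarith) (by linarith [hω x])
    have h3 : (1 - α) * ρ * (β * (1 + ω x)) ≤ (1 - α) * ρ * (1 + β * ω x) :=
      mul_le_mul_of_nonneg_left (by linarith) (mul_nonneg hα.le hρ0.le)
    linarith
  set T := bellmanOperator P W U G F γ with hT
  set S : (Vec k → ℝ) → Vec k → ℝ := fun f x => T f x - T f 0 + u₀ 0 with hS
  set u : ℕ → Vec k → ℝ := fun n => S^[n] u₀ with hudef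
  have husucc : ∀ n x, u (n + 1) x = T (u n) x - T (u n) 0 + u₀ 0 := fun n x => by
    simp only [hudef, Function.iterate_succ_apply', hS]
  have hu : ∀ n, Continuous (u n) ∧ u n 0 = u₀ 0 ∧
      WeightedSpanLE ω β ρ (fun x => u n x - u₀ x) := by
    intro n
    induction n with
    | zero =>
      refine ⟨hu₀.1, rfl, fun x y => ?_⟩
      simp only [hudef, Function.iterate_zero, id_eq, sub_self]
      have := mul_nonneg hβ0.le (hω x)
      have := mul_nonneg hβ0.le (hω y)
      positivity
    | succ n ih =>
      obtain ⟨hc, h0, hs⟩ := ih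
      have hgn := hballM _ hc h0 hs
      refine ⟨?_, ?_, ?_⟩
      · rw [show u (n + 1) = fun x => T (u n) x - T (u n) 0 + u₀ 0 from funext (husucc n)]
        exact ((hA.continuous_bellmanOperator hM hgn hc).sub continuous_const).add
          continuous_const
      · rw [husucc, sub_self, zero_add]
      · have h1 := (hcon γ hγ _ hgn u₀ hg₀' ρ hρ0 hs).add hstep
        intro x y
        have h2 := h1 x y
        simp only [husucc, h₀] at h2 ⊢
        linarith
  have hinc : ∀ n : ℕ, WeightedSpanLE ω β (α ^ n * ((1 - α) * ρ))
      (fun x => u (n + 1) x - u n x) := by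
    intro n
    induction n with
    | zero =>
      intro x y
      have h2 := hstep x y
      simp only [husucc, h₀, pow_zero, one_mul] at h2 ⊢
      simp only [hudef, Function.iterate_zero, id_eq] at h2 ⊢
      linarith
    | succ n ih =>
      have h1 := hcon γ hγ _ (hballM _ (hu (n + 1)).1 (hu (n + 1)).2.1 (hu (n + 1)).2.2) _
        (hballM _ (hu n).1 (hu n).2.1 (hu n).2.2) _ (by positivity) ih
      intro x y
      have h2 := h1 x y
      beta_reduce at h2 ⊢
      rw [husucc (n + 1) x, husucc (n + 1) y, husucc n x, husucc n y, pow_succ']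
      linarith
  obtain ⟨v, hvc, hv0, hv⟩ := WeightedSpanLE.exists_limit hA.continuous_weight hβ0.le
    (by positivity) hα0.le hα1 (fun n => (hu n).1) (fun n => (hu n).2.1) hinc
  rw [mul_div_cancel_left₀ _ hα.ne'] at hv
  have hvs : WeightedSpanLE ω β ρ (fun x => v x - u₀ x) := by
    simpa only [pow_zero, one_mul, hudef, Function.iterate_zero, id_eq] using hv 0
  have hgv := hballM v hvc hv0 hvs
  -- Up to constants `T v - v` is `(T v - T (u n)) + (u (n + 1) - v)`, and each term has oscillation
  -- at most `α ^ (n + 1) * ρ`.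
  have hfix : ∀ n : ℕ, WeightedSpanLE ω β (α ^ n * (2 * α * ρ)) (fun x => T v x - v x) := by
    intro n x y
    have h1 := hcon γ hγ v hgv _ (hballM _ (hu n).1 (hu n).2.1 (hu n).2.2) _
      (by positivity) (hv n) x y
    have h2 := hv (n + 1) y x
    simp only [husucc, pow_succ'] at h1 h2
    linarith
  have hconst := WeightedSpanLE.eq_of_forall_pow hα0.le hα1 hfix
  have hvT : ∀ x, T v x = v x + (T v 0 - v 0) := fun x => by linarith [hconst x 0]
  refine ⟨v, T v 0 - v 0, mem_weightedSpace_of_abs_le hω hvc hgv.abs_le, hvT, fun x => ?_, ?_⟩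
  · exact (hball v hv0 hvs x).trans (mul_le_mul_of_nonneg_right
      ((min_le_left _ _).trans (min_le_right _ _)) (by linarith [hω x]))
  · have h1 := hlip γ hγ γ₀ hγ₀ v hgv u₀ hg₀' ε₂ hε₂0.le (hball v hv0 hvs) 0
    rw [h₀] at h1
    have h2 : K * (|γ - γ₀| + ε₂) * (1 + ω 0) ≤ K * (ε₁ + ε₁) * (1 + ω 0) :=
      mul_le_mul_of_nonneg_right (mul_le_mul_of_nonneg_left
        (add_le_add hd2 (min_le_right _ _)) hK.le) (by linarith)
    have h3 : K * (ε₁ + ε₁) * (1 + ω 0) = ε := by rw [hε₁]; field_simp; ring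
    rw [show T v 0 - v 0 - κ₀ = T v 0 - (u₀ 0 + κ₀) by rw [hv0]; ring]
    linarith

/-- The seed of the perturbation: at `γ = 0` the control drops out. -/
theorem bellmanOperator_zero (x : Vec k) :
    bellmanOperator P W U G F 0 (fun _ => 0) x = 0 := by
  have := hA.nonempty_control
  simp [bellmanOperator]

end MarketAssumptions

theorem IsBellmanSolution.bellmanOperator_eq {Ω : Type*} [MeasurableSpace Ω] {P : Measure Ω}
    {k m : ℕ} {W : ℕ → Ω → Vec (k + m)} {U : Set (Vec m)} {G : Vec k → Vec (k + m) → Vec k}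
    {F : Vec k → U → Vec (k + m) → ℝ} {ω : Vec k → ℝ} {γ l : ℝ} {u : Vec k → ℝ}
    (h : IsBellmanSolution P W U G F ω γ u l) (x : Vec k) :
    bellmanOperator P W U G F γ u x = u x + l * γ :=
  (h.2 x).symm

/-! ### The theorem -/

theorem mainTheorem5 {Ω : Type*} [MeasurableSpace Ω] (P : Measure Ω) [IsProbabilityMeasure P]
    {k m : ℕ} (W : ℕ → Ω → Vec (k + m)) (U : Set (Vec m))
    (G : Vec k → Vec (k + m) → Vec k) (F : Vec k → U → Vec (k + m) → ℝ)
    (ω : Vec k → ℝ) (a₁ a₂ : Vec (k + m) → ℝ) (b₁ b₂ : ℝ)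
    (hA : MarketAssumptions P W U G F ω a₁ a₂ b₁ b₂) :
    (∃ γ₀ : ℝ, γ₀ < 0 ∧ ∀ γ ∈ Ioo γ₀ 0, ∃ (u : Vec k → ℝ) (l : ℝ),
      IsBellmanSolution P W U G F ω γ u l ∧
      ∀ (u' : Vec k → ℝ) (l' : ℝ), IsBellmanSolution P W U G F ω γ u' l' →
        l' = l ∧ ∃ c : ℝ, ∀ x, u' x = u x + c) ∧
    (∀ γ₀ : ℝ, γ₀ < 0 → ∀ (u : ℝ → Vec k → ℝ) (l : ℝ → ℝ),
      (∀ γ ∈ Ioo γ₀ 0, IsBellmanSolution P W U G F ω γ (u γ) (l γ)) →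
        ContinuousOn l (Ioo γ₀ 0) ∧
        ∀ a x : Vec k, ContinuousOn (fun γ => u γ x - u γ a) (Ioo γ₀ 0)) := by
  constructor
  · have hz : (fun _ => 0 : Vec k → ℝ) ∈ weightedSpace ω :=
      mem_weightedSpace_of_abs_le hA.weight_nonneg continuous_const (M := 0) (by simp)
    obtain ⟨δ, hδ, h⟩ := hA.exists_perturbed_eigenfunction (γ₀ := 0) (κ₀ := 0) hz
      (fun x => by rw [hA.bellmanOperator_zero, add_zero]) one_pos
    refine ⟨-δ, neg_lt_zero.2 hδ, fun γ hγ => ?_⟩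
    obtain ⟨v, κ, hv, hvκ, -, -⟩ := h γ (by rw [sub_zero, abs_of_neg hγ.2]; linarith [hγ.1])
    refine ⟨v, κ / γ, ⟨hv, fun x => ?_⟩, fun u' l' h' => ?_⟩
    · rw [hvκ, div_mul_cancel₀ _ hγ.2.ne]
    · obtain ⟨h1, h2⟩ := hA.eigenfunction_unique hv h'.1 hvκ h'.bellmanOperator_eq
      exact ⟨by rw [← h1, mul_div_cancel_right₀ _ hγ.2.ne], h2⟩
  · intro γ₀ _ u l hul
    -- By uniqueness the given solution at `γ'` is, up to a constant `c`, the one obtained by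
    -- perturbing the given solution at `γ`.
    have key : ∀ γ ∈ Ioo γ₀ 0, ∀ ε > 0, ∃ δ > 0, ∀ γ' ∈ Ioo γ₀ 0, dist γ' γ < δ →
        |l γ' * γ' - l γ * γ| ≤ ε ∧
        ∃ c, ∀ x, |u γ' x - c - u γ x| ≤ ε * (1 + ω x) := by
      intro γ hγ ε hε
      obtain ⟨δ, hδ, h⟩ := hA.exists_perturbed_eigenfunction (hul γ hγ).1
        (hul γ hγ).bellmanOperator_eq hε
      refine ⟨δ, hδ, fun γ' hγ' hd => ?_⟩
      obtain ⟨v, κ, hv, hvκ, hvu, hκ⟩ := h γ' (by rwa [← Real.dist_eq])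
      obtain ⟨h1, c, hc⟩ := hA.eigenfunction_unique hv (hul γ' hγ').1 hvκ
        (hul γ' hγ').bellmanOperator_eq
      exact ⟨by rwa [h1], c, fun x => by rw [hc, add_sub_cancel_right]; exact hvu x⟩
    constructor
    -- The eigenvalue is `l γ * γ`; dividing by `γ ≠ 0` recovers `l`.
    · have hκ : ContinuousOn (fun γ => l γ * γ) (Ioo γ₀ 0) := by
        refine Metric.continuousOn_iff.2 fun γ hγ ε hε => ?_
        obtain ⟨δ, hδ, h⟩ := key γ hγ (ε / 2) (half_pos hε)
        refine ⟨δ, hδ, fun γ' hγ' hd => ?_⟩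
        rw [Real.dist_eq]
        linarith [(h γ' hγ' hd).1]
      refine (hκ.div continuousOn_id fun γ hγ => hγ.2.ne).congr fun γ hγ => ?_
      exact (mul_div_cancel_right₀ _ hγ.2.ne).symm
    · intro a x
      refine Metric.continuousOn_iff.2 fun γ hγ ε hε => ?_
      have hω : 0 < 2 + ω x + ω a := by
        linarith [hA.weight_nonneg x, hA.weight_nonneg a]
      obtain ⟨δ, hδ, h⟩ := key γ hγ (ε / 2 / (2 + ω x + ω a)) (by positivity)
      refine ⟨δ, hδ, fun γ' hγ' hd => ?_⟩
      obtain ⟨-, c, hc⟩ := h γ' hγ' hd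
      -- The unknown constant `c` cancels between `x` and `a`.
      have h1 := abs_sub (u γ' x - c - u γ x) (u γ' a - c - u γ a)
      have h2 : ε / 2 / (2 + ω x + ω a) * (1 + ω x) + ε / 2 / (2 + ω x + ω a) * (1 + ω a)
          = ε / 2 := by field_simp; ring
      rw [Real.dist_eq, show u γ' x - u γ' a - (u γ x - u γ a)
        = u γ' x - c - u γ x - (u γ' a - c - u γ a) by ring]
      linarith [hc x, hc a]
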